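/- Let $G$ be a graph of type $4_n$, i.e. a finite simple $3$-connected $3$-valent plane graph with $n$ vertices, all of whose faces are $4$-gons or $6$-gons. A zigzag of $G$ is a circuit of edges in which, on tracing it, one takes as next edge alternately the left and the right neighbour of the current edge at the vertex reached; zigzags are considered up to the direction of tracing. A zigzag is simple if it does not pass twice through the same edge. Let $Z\neq Z'$ be two simple zigzags of $G$ with at least one edge in common. Let $H$ be the plane $4$-valent graph whose vertices are the common edges of $Z$ and $Z'$ and whose edges are the arcs of $Z$ and of $Z'$ between consecutive common edges. At each vertex of $H$, i.e. at each common edge $uv$, there are four angles between the arcs: two opposite acute ones, located at the vertices $u$ and $v$ of $G$, and two opposite obtuse ones, located on the two sides of the edge $uv$. Then, for some $k\in\{1,2,3\}$, the graph $H$ is the cyclic necklace of $2k$ digons with acute angles: the common edges of $Z$ and $Z'$ can be listed without repetition in a cyclic order $e_0,\dots,e_{2k-1}$ and directed so that, for each $i$ modulo $2k$, the two arcs (one of $Z$ and one of $Z'$) that leave $e_i$ at its head have no common edge of $Z$ and $Z'$ in their interior, both end at the tail of $e_{i+1}$, and bound a $2$-gonal face of $H$ whose two angles (at the head of $e_i$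 and at the tail of $e_{i+1}$) are acute. (The remaining faces of $H$ are then two $2k$-gons, with all angles obtuse, bounded alternately by arcs of $Z$ and of $Z'$.) In particular, the number of edges common to $Z$ and $Z'$ is $2$, $4$ or $6$. -/

import Mathlib

/-- A drawing of the graph `G` on an oriented closed surface, given combinatorially (a rotation
system): `rot` sends each dart (edge directed away from its first end) to the next dart, in
counter-clockwise order, with the same first end. At each vertex the darts form one cycle. -/
structure RotationSystem {V : Type*} (G : SimpleGraph V) where
  rot : Equiv.Perm G.Dart
  rot_fst : ∀ d, (rot d).fst = d.fst
  cyclic : ∀ d d' : G.Dart, d.fst = d'.fst → rot.SameCycle d d'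

namespace RotationSystem

variable {V : Type*} {G : SimpleGraph V}

/-- The permutation of darts that walks around the faces: cross the edge, then turn to the next
edge in counter-clockwise order. Its cycles are the faces. -/
def facePerm (R : RotationSystem G) : Equiv.Perm G.Dart :=
  (SimpleGraph.Dart.symm_involutive (G := G)).toPerm.trans R.rot

/-- The faces of the drawing. -/
def Face (R : RotationSystem G) : Type _ :=
  Quotient (Equiv.Perm.SameCycle.setoid R.facePerm)

/-- The number of sides of the face whose boundary walk contains the dart `d`. -/
noncomputable def faceSize (R : RotationSystem G) (d : G.Dart) : ℕ :=
  Function.minimalPeriod R.facePerm d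

/-- The drawing lies in the sphere (equivalently, in the plane): `G` is connected and Euler's
relation `V - E + F = 2` holds. -/
def IsPlane (R : RotationSystem G) : Prop :=
  G.Connected ∧
    (Nat.card V : ℤ) - (Nat.card G.edgeSet : ℤ) + (Nat.card R.Face : ℤ) = 2

end RotationSystem

/-- `3`-connectedness: more than three vertices, and no removal of at most two vertices
disconnects the graph. -/
def IsThreeConnected {V : Type*} (G : SimpleGraph V) : Prop :=
  3 < Nat.card V ∧ ∀ S : Set V, S.ncard ≤ 2 → (G.induce Sᶜ).Connected

/-- The graphs of type `4_n`: `3`-valent plane graphs of `n`-vertex polyhedra (that is, simple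
`3`-connected plane graphs) all of whose faces are `4`-gons or `6`-gons. -/
structure IsTypeFour {V : Type*} {G : SimpleGraph V} (R : RotationSystem G) (n : ℕ) : Prop where
  card_eq : Nat.card V = n
  plane : R.IsPlane
  threeConnected : IsThreeConnected G
  cubic : ∀ v, (G.neighborSet v).ncard = 3
  faces : ∀ d, R.faceSize d = 4 ∨ R.faceSize d = 6

/-- A state of a left-right walk: the edge being traversed, with the direction of traversal, and
the turn to be made at its end (`true` for left, `false` for right). -/
abbrev ZigzagState {V : Type*} (G : SimpleGraph V) : Type _ := G.Dart × Bool

/-- The same passage through an edge, traversed backwards. If a left-right walk makes a given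
turn after an edge, it has made the other turn before it, and this one becomes the given turn
again when walked backwards; so the Boolean does not change. -/
def ZigzagState.rev {V : Type*} {G : SimpleGraph V} (x : ZigzagState G) : ZigzagState G :=
  (x.1.symm, x.2)

/-- The edge traversed in a state. -/
def ZigzagState.edge {V : Type*} {G : SimpleGraph V} (x : ZigzagState G) : Sym2 V :=
  x.1.edge

namespace RotationSystem

variable {V : Type*} {G : SimpleGraph V}

/-- One step of a left-right walk: arriving along an edge, take as next edge its left neighbour
(the next one in counter-clockwise order) or its right neighbour (the preceding one), as the
state prescribes, and prescribe the other turn for the next step. -/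
def step (R : RotationSystem G) : Equiv.Perm (ZigzagState G) where
  toFun x := (if x.2 then R.rot x.1.symm else R.rot.symm x.1.symm, !x.2)
  invFun x := (if x.2 then (R.rot x.1).symm else (R.rot.symm x.1).symm, !x.2)
  left_inv x := by rcases x with ⟨d, b⟩; cases b <;> simp
  right_inv x := by rcases x with ⟨d, b⟩; cases b <;> simp

/-- The zigzag through the state `x`, as the set of all states met when its circuit of edges is
traversed, in either direction. -/
def zigzagOf (R : RotationSystem G) (x : ZigzagState G) : Set (ZigzagState G) :=
  {y | R.step.SameCycle x y ∨ R.step.SameCycle x y.rev}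

/-- `Z` is a zigzag (with both of its directions of traversal). -/
def IsZigzag (R : RotationSystem G) (Z : Set (ZigzagState G)) : Prop :=
  ∃ x, Z = R.zigzagOf x

end RotationSystem

/-- The set of edges of a zigzag. -/
def zigzagEdges {V : Type*} {G : SimpleGraph V} (Z : Set (ZigzagState G)) : Set (Sym2 V) :=
  ZigzagState.edge '' Z

/-- A zigzag is simple if it has no self-intersection: it passes through no edge twice, so that
two states at the same edge are the same passage, up to the direction of traversal. -/
def IsSimpleZigzag {V : Type*} {G : SimpleGraph V} (Z : Set (ZigzagState G)) : Prop :=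
  ∀ x ∈ Z, ∀ y ∈ Z, x.edge = y.edge → y = x ∨ y = x.rev

namespace RotationSystem

variable {V : Type*} {G : SimpleGraph V}

/-- Following the zigzag from the state `x`, the state `y` is the first one after `x` whose edge
lies in `C`. -/
def IsNextIn (R : RotationSystem G) (C : Set (Sym2 V)) (x y : ZigzagState G) : Prop :=
  ∃ m : ℕ, 0 < m ∧ (R.step ^ m) x = y ∧ y.edge ∈ C ∧
    ∀ j : ℕ, 0 < j → j < m → ((R.step ^ j) x).edge ∉ C

/-- Let `C` be the set of common edges of two zigzags, `d` and `d'` two directed common edges.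
At the head of `d` the two zigzags separate, one turning left and one turning right, with an acute
angle (a vertex of the graph) between them. `AcuteDigon C d d'` says that the two arcs that leave
`d` there both have `d'` as the next common edge and meet again at the tail of `d'`, the arc that
left `d` on one side arriving on this same side of `d'`: thus the two arcs bound a `2`-gon with two
acute angles, at the head of `d` and at the tail of `d'`. (An arc that arrives from the side of the
left turn must turn right at the end of `d'`, and conversely; hence the negation.) -/
def AcuteDigon (R : RotationSystem G) (C : Set (Sym2 V)) (d d' : G.Dart) : Prop :=
  ∀ b : Bool, R.IsNextIn C (d, b) (d', !b)

/-- The intersection of `Z` and `Z'` is a necklace of `2 * k` digons: the common edges, suitably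
directed and listed without repetition in a cyclic order `d 0, …, d (2 * k - 1)`, are such that any
two cyclically consecutive ones are joined by a `2`-gon with two acute angles. This determines the
plane `4`-valent graph formed by the common edges (as vertices) and the arcs of `Z` and `Z'`
between them, with all its angles: since `d (i + 1)` is entered on one side and left on the other,
each zigzag crosses the necklace from side to side at every common edge, and the remaining angles,
all obtuse (an edge of the graph), lie on the two sides of the necklace, which are two `2 * k`-gons
bounded alternately by arcs of `Z` and of `Z'`. -/
def IsNecklace (R : RotationSystem G) (k : ℕ) (Z Z' : Set (ZigzagState G)) : Prop :=
  ∃ d : ZMod (2 * k) → G.Dart,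
    Function.Injective (fun i => (d i).edge) ∧
    Set.range (fun i => (d i).edge) = zigzagEdges Z ∩ zigzagEdges Z' ∧
    ∀ i, R.AcuteDigon (zigzagEdges Z ∩ zigzagEdges Z') (d i) (d (i + 1))

end RotationSystem

/-! Draw a zigzag as a curve through the midpoints of its edges, cutting off the corner between each
edge and the next. The curves of two distinct simple zigzags meet only at the midpoints of the
common edges, and divide the sphere into regions; a vertex and a face lie in one region if they are
linked through corners that are not cut.

Curvature bounds the corners of a region. Vertices of degree three and hexagons are flat and smaller
faces are positively curved, so a region, whose Euler characteristic is at most one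
(`euler_region_le`), with α acute and β obtuse corners satisfies 2α + β ≤ 6 (`region_corners_le`).

Parity governs the arcs. Even faces make the graph bipartite, and the edges of a simple zigzag form
a cut (`exists_cut`). Every edge of Z' switches both the colour and the side of its cut, so their
sum is constant along Z'. An arc of Z between consecutive common edges stays on one side of this cut
until the last edge; comparing colours, it ends with the turn opposite to its first
(`snd_eq_not_of_isNextIn`). Hence an arc leaving an acute corner of a region reaches another acute
corner of that region. The sides met in this way alternate between Z and Z', so the number of
corners is even, and being at most three it is two: a digon (`acuteDigon`).

Following Z from digon to digon meets each common edge once, with alternating turns, hence an even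
number 2k of them. The obtuse corners on one side of this necklace all lie in one region, so 2k ≤ 6.
-/

open scoped Matrix

/-- A function invariant under a permutation is constant on its cycles. -/
theorem Equiv.Perm.SameCycle.apply_eq_of_invariant {α X : Type*} {σ : Equiv.Perm α} {a b : α}
    (h : σ.SameCycle a b) (g : α → X) (hg : ∀ a, g (σ a) = g a) : g a = g b := by
  obtain ⟨i, rfl⟩ := h
  induction i with
  | zero => simp
  | succ i ih => rw [ih, ← hg, ← Equiv.Perm.mul_apply, add_comm, zpow_add, zpow_one]
  | pred i ih =>
    rw [ih, ← hg ((σ ^ (-(i : ℤ) - 1)) a), ← Equiv.Perm.mul_apply, ← zpow_one_add]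
    congr 3
    ring

/-! ### Faces and connectedness of a rotation system. -/

namespace RotationSystem

variable {V : Type*} {G : SimpleGraph V}

/-- The face whose boundary walk contains the dart `d`. -/
def face (R : RotationSystem G) (d : G.Dart) : R.Face :=
  Quotient.mk (Equiv.Perm.SameCycle.setoid R.facePerm) d

theorem facePerm_apply (R : RotationSystem G) (d : G.Dart) : R.facePerm d = R.rot d.symm := rfl

theorem face_eq_iff (R : RotationSystem G) {d d' : G.Dart} :
    R.face d = R.face d' ↔ R.facePerm.SameCycle d d' :=
  Quotient.eq (r := Equiv.Perm.SameCycle.setoid R.facePerm)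

@[simp]
theorem face_rot (R : RotationSystem G) (d : G.Dart) : R.face (R.rot d) = R.face d.symm := by
  rw [face_eq_iff]
  simpa [facePerm_apply] using
    (Equiv.Perm.sameCycle_apply_left (f := R.facePerm) (x := d.symm) (y := d.symm)).2
      (Equiv.Perm.SameCycle.refl _ _)

theorem face_surjective (R : RotationSystem G) : Function.Surjective R.face :=
  Quotient.mk_surjective

instance finiteDart [Finite V] : Finite G.Dart :=
  Finite.of_injective (fun d => d.toProd) SimpleGraph.Dart.toProd_injective

instance finiteFace [Finite V] (R : RotationSystem G) : Finite R.Face :=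
  Finite.of_surjective _ R.face_surjective

/-- A function of darts that does not change when a dart is rotated or reversed is constant. -/
theorem eq_of_rot_of_symm (R : RotationSystem G) (hG : G.Connected) {X : Type*} (g : G.Dart → X)
    (hrot : ∀ d, g (R.rot d) = g d) (hsymm : ∀ d, g d.symm = g d) (d d' : G.Dart) :
    g d = g d' := by
  have hv : ∀ d d' : G.Dart, d.fst = d'.fst → g d = g d' := by
    intro d d' h
    exact (R.cyclic d d' h).apply_eq_of_invariant g hrot
  have key : ∀ u v : V, G.Reachable u v → ∀ d d' : G.Dart, d.fst = u → d'.fst = v →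
      g d = g d' := by
    rintro u v ⟨p⟩
    induction p with
    | nil => rintro d d' h h'; exact hv _ _ (h.trans h'.symm)
    | cons h p ih =>
      intro d d' hd hd'
      rw [hv d ⟨(_, _), h⟩ hd, ← hsymm]
      exact ih _ _ rfl hd'
  exact key _ _ (hG.preconnected _ _) d d' rfl rfl

end RotationSystem

/-! ### Incidence matrices modulo two. -/

/-- If only constant functions lie in the kernel, the corank is at most one. -/
theorem Matrix.card_le_rank_add_one {K m n : Type*} [Field K] [Fintype m] [Fintype n]
    (M : Matrix m n K) (h : ∀ φ : n → K, M *ᵥ φ = 0 → ∀ i j, φ i = φ j) :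
    Fintype.card n ≤ M.rank + 1 := by
  have h1 : Module.finrank K (LinearMap.ker M.mulVecLin) ≤ 1 := by
    by_cases hn : Nonempty n
    · obtain ⟨i⟩ := hn
      by_cases h0 : ∃ w : LinearMap.ker M.mulVecLin, w.1 i ≠ 0
      · obtain ⟨w, hw⟩ := h0
        refine finrank_le_one w fun u => ⟨u.1 i / w.1 i, ?_⟩
        ext j
        have h1 := h u.1 (LinearMap.mem_ker.1 u.2) i j
        have h2 := h w.1 (LinearMap.mem_ker.1 w.2) i j
        simp only [SetLike.val_smul, Pi.smul_apply, smul_eq_mul]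
        rw [← h2, ← h1]
        field_simp
      · push Not at h0
        refine finrank_le_one 0 fun u => ⟨0, ?_⟩
        ext j
        simp [← h u.1 (LinearMap.mem_ker.1 u.2) i j, h0]
    · rw [not_nonempty_iff] at hn
      exact (Submodule.finrank_le _).trans (by simp)
  have h2 := LinearMap.finrank_range_add_finrank_ker M.mulVecLin
  rw [Module.finrank_fintype_fun_eq_card] at h2
  simp only [Matrix.rank]
  omega

namespace SimpleGraph

variable {V : Type*} (G : SimpleGraph V)

open scoped Classical in
/-- The incidence matrix, modulo two, between edges and any objects to which darts belong. -/
noncomputable def dartMatrix {X : Type*} [Fintype G.Dart] (g : G.Dart → X) :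
    Matrix G.edgeSet X (ZMod 2) :=
  fun e x => ∑ d : G.Dart, if d.edge = e ∧ g d = x then 1 else 0

open scoped Classical in
theorem sum_dart_edge {M : Type*} [AddCommMonoid M] [Fintype G.Dart] (f : G.Dart → M)
    (d : G.Dart) : (∑ d' : G.Dart, if d'.edge = d.edge then f d' else 0) = f d + f d.symm := by
  have h : (Finset.univ.filter fun d' : G.Dart => d'.edge = d.edge) = {d, d.symm} := by
    ext d'
    simp [dart_edge_eq_iff]
  rw [← Finset.sum_filter, h, Finset.sum_pair d.symm_ne.symm]

-- With first ends for `g` this is the coboundary of a function of vertices; with faces for `g` it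
-- is the same for the dual graph. Working modulo two avoids orientations.
open scoped Classical in
theorem dartMatrix_mulVec {X : Type*} [Fintype G.Dart] [Fintype X] (g : G.Dart → X)
    (φ : X → ZMod 2) (d : G.Dart) :
    (G.dartMatrix g *ᵥ φ) ⟨d.edge, d.edge_mem⟩ = φ (g d) + φ (g d.symm) := by
  rw [← G.sum_dart_edge (fun d => φ (g d))]
  simp only [Matrix.mulVec, dotProduct, dartMatrix, Finset.sum_mul]
  rw [Finset.sum_comm]
  refine Finset.sum_congr rfl fun d' _ => ?_
  simp [ite_and, Finset.sum_ite_eq]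

open scoped Classical in
theorem dartMatrix_transpose_mulVec {X : Type*} [Fintype G.Dart] [Fintype G.edgeSet]
    (g : G.Dart → X) (y : G.edgeSet → ZMod 2) (x : X) :
    ((G.dartMatrix g)ᵀ *ᵥ y) x = ∑ d : G.Dart, if g d = x then y ⟨d.edge, d.edge_mem⟩ else 0 := by
  simp only [Matrix.mulVec, dotProduct, dartMatrix, Matrix.transpose]
  simp only [Matrix.of_apply, Finset.sum_mul]
  rw [Finset.sum_comm]
  refine Finset.sum_congr rfl fun d _ => ?_
  rw [Finset.sum_eq_single ⟨d.edge, d.edge_mem⟩]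
  · simp
  · intro e _ he
    have : d.edge ≠ e := fun h => he (Subtype.ext h.symm)
    simp [this]
  · simp

end SimpleGraph

theorem ZMod.eq_of_add_eq_zero {a b : ZMod 2} (h : a + b = 0) : a = b := by
  revert a b; decide

/-! ### Exactness on the sphere: potentials, bicolouring. -/

namespace RotationSystem

variable {V : Type*} {G : SimpleGraph V}

-- `facePerm` permutes the darts of each face.
open scoped Classical in
theorem sum_face_facePerm {M : Type*} [AddCommMonoid M] [Fintype G.Dart] (R : RotationSystem G)
    (f : R.Face) (g : G.Dart → M) :
    (∑ d : G.Dart, if R.face d = f then g (R.facePerm d) else 0) =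
      ∑ d : G.Dart, if R.face d = f then g d else 0 := by
  rw [← Equiv.sum_comp R.facePerm fun d => if R.face d = f then g d else 0]
  refine Finset.sum_congr rfl fun d _ => ?_
  simp [facePerm_apply]

open scoped Classical in
/-- On a plane drawing, a function of edges whose sum around each face vanishes modulo two is
the coboundary of a function of vertices. -/
theorem exists_potential [Finite V] [Fintype G.Dart] (R : RotationSystem G) (hR : R.IsPlane)
    (y : Sym2 V → ZMod 2)
    (hy : ∀ f : R.Face, (∑ d : G.Dart, if R.face d = f then y d.edge else 0) = 0) :
    ∃ c : V → ZMod 2, ∀ d : G.Dart, c d.fst + c d.snd = y d.edge := by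
  have := Fintype.ofFinite V
  have := Fintype.ofFinite R.Face
  have := Fintype.ofFinite G.edgeSet
  obtain ⟨hconn, heuler⟩ := hR
  simp only [Nat.card_eq_fintype_card] at heuler
  set A := (G.dartMatrix R.face)ᵀ with hA
  set B := G.dartMatrix (fun d => d.fst) with hB
  have hAr : Fintype.card R.Face ≤ A.rank + 1 := by
    rw [hA, Matrix.rank_transpose]
    refine Matrix.card_le_rank_add_one _ fun φ hφ => ?_
    have h1 : ∀ d : G.Dart, φ (R.face d.symm) = φ (R.face d) := by
      intro d
      have := congrFun hφ ⟨d.edge, d.edge_mem⟩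
      rw [SimpleGraph.dartMatrix_mulVec] at this
      exact (ZMod.eq_of_add_eq_zero this).symm
    intro i j
    obtain ⟨d, rfl⟩ := R.face_surjective i
    obtain ⟨d', rfl⟩ := R.face_surjective j
    exact R.eq_of_rot_of_symm hconn (fun d => φ (R.face d)) (by simp [h1]) h1 d d'
  have hBr : Fintype.card V ≤ B.rank + 1 := by
    refine Matrix.card_le_rank_add_one _ fun φ hφ => ?_
    have h1 : ∀ u v : V, G.Adj u v → φ u = φ v := by
      intro u v h
      have := congrFun hφ ⟨_, SimpleGraph.Dart.edge_mem ⟨(u, v), h⟩⟩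
      rw [hB, SimpleGraph.dartMatrix_mulVec] at this
      exact ZMod.eq_of_add_eq_zero this
    intro i j
    obtain ⟨p⟩ := hconn.preconnected i j
    induction p with
    | nil => rfl
    | cons h p ih => exact (h1 _ _ h).trans ih
  -- Coboundaries sum to zero around a face: its darts have as second ends their first ends, shifted
  -- by `facePerm`.
  have hle : LinearMap.range B.mulVecLin ≤ LinearMap.ker A.mulVecLin := by
    rintro _ ⟨c, rfl⟩
    rw [LinearMap.mem_ker]
    ext f
    simp only [Matrix.mulVecLin_apply, hA, SimpleGraph.dartMatrix_transpose_mulVec, hB,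
      SimpleGraph.dartMatrix_mulVec, Pi.zero_apply]
    have h1 := R.sum_face_facePerm f (fun d => c d.fst)
    simp only [facePerm_apply, R.rot_fst] at h1
    have h2 : ∀ d : G.Dart, (if R.face d = f then c d.fst + c d.symm.fst else 0) =
        (if R.face d = f then c d.fst else 0) + if R.face d = f then c d.symm.fst else 0 := by
      intro d; split_ifs <;> simp
    simp only [h2, Finset.sum_add_distrib, h1]
    exact CharTwo.add_self_eq_zero _
  have hker := LinearMap.finrank_range_add_finrank_ker A.mulVecLin
  rw [Module.finrank_fintype_fun_eq_card] at hker
  -- By Euler's relation, dim ker A = E - rank A ≤ E - F + 1 = V - 1 ≤ rank B.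
  have heq := Submodule.eq_of_le_of_finrank_le hle (by
    simp only [Matrix.rank] at hAr hBr
    omega)
  have hmem : (fun e : G.edgeSet => y e) ∈ LinearMap.range B.mulVecLin := by
    rw [heq, LinearMap.mem_ker]
    ext f
    simp only [Matrix.mulVecLin_apply, hA, SimpleGraph.dartMatrix_transpose_mulVec, hy,
      Pi.zero_apply]
  obtain ⟨c, hc⟩ := hmem
  refine ⟨c, fun d => ?_⟩
  have := congrFun hc ⟨d.edge, d.edge_mem⟩
  rw [Matrix.mulVecLin_apply, hB, SimpleGraph.dartMatrix_mulVec] at this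
  exact this

open scoped Classical in
/-- The number of darts on a face is its size. -/
theorem card_face [Fintype G.Dart] (R : RotationSystem G) (d : G.Dart) :
    (Finset.univ.filter fun d' => R.face d' = R.face d).card = R.faceSize d := by
  have h := MulAction.minimalPeriod_eq_card R.facePerm d
  have h2 : Function.minimalPeriod (R.facePerm • ·) d = R.faceSize d := rfl
  rw [← h2, h, ← Set.toFinset_card]
  congr 1
  ext d'
  simp only [Finset.mem_filter, Finset.mem_univ, true_and, Set.mem_toFinset, MulAction.mem_orbit_iff]
  rw [eq_comm, face_eq_iff]
  constructor
  · rintro ⟨i, rfl⟩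
    exact ⟨⟨_, i, rfl⟩, rfl⟩
  · rintro ⟨⟨_, i, rfl⟩, rfl⟩
    exact ⟨i, rfl⟩

open scoped Classical in
/-- A plane drawing whose faces are all even is bipartite. -/
theorem exists_bicoloring [Finite V] (R : RotationSystem G) (hR : R.IsPlane)
    (h : ∀ d, Even (R.faceSize d)) :
    ∃ c : V → ZMod 2, ∀ d : G.Dart, c d.snd = c d.fst + 1 := by
  have := Fintype.ofFinite G.Dart
  obtain ⟨c, hc⟩ := R.exists_potential hR (fun _ => 1) (by
    intro f
    obtain ⟨d, rfl⟩ := R.face_surjective f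
    rw [← Finset.sum_filter, Finset.sum_const, R.card_face, nsmul_eq_mul, mul_one]
    exact (ZMod.natCast_eq_zero_iff_even).2 (h d))
  refine ⟨c, fun d => ?_⟩
  rw [← hc d, ← add_assoc, CharTwo.add_self_eq_zero, zero_add]

/-! ### Zigzags, their unions, and parity along arcs. -/

@[simp]
theorem rot_symm_fst (R : RotationSystem G) (d : G.Dart) : (R.rot.symm d).fst = d.fst := by
  rw [← R.rot_fst, Equiv.apply_symm_apply]

@[simp]
theorem step_fst (R : RotationSystem G) (x : ZigzagState G) : (R.step x).1.fst = x.1.snd := by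
  rcases x with ⟨d, b⟩
  cases b <;> simp [step, R.rot_fst]

@[simp]
theorem step_snd (R : RotationSystem G) (x : ZigzagState G) : (R.step x).2 = !x.2 := rfl

theorem step_true (R : RotationSystem G) (d : G.Dart) :
    R.step (d, true) = (R.rot d.symm, false) := rfl

theorem step_false (R : RotationSystem G) (d : G.Dart) :
    R.step (d, false) = (R.rot.symm d.symm, true) := rfl

@[simp]
theorem _root_.ZigzagState.rev_rev (x : ZigzagState G) : x.rev.rev = x := by
  simp [ZigzagState.rev]

@[simp]
theorem _root_.ZigzagState.rev_edge (x : ZigzagState G) : x.rev.edge = x.edge := by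
  simp [ZigzagState.rev, ZigzagState.edge]

-- Reversal conjugates `step` to its inverse.
@[simp]
theorem step_rev_step (R : RotationSystem G) (x : ZigzagState G) :
    R.step (R.step x).rev = x.rev := by
  rcases x with ⟨d, b⟩
  cases b <;> simp [step, ZigzagState.rev]

/-- A set of states made up of whole zigzags. -/
structure IsZigzagUnion (R : RotationSystem G) (Y : Set (ZigzagState G)) : Prop where
  step_mem : ∀ x, R.step x ∈ Y ↔ x ∈ Y
  rev_mem : ∀ x : ZigzagState G, x.rev ∈ Y ↔ x ∈ Y

namespace IsZigzagUnion

variable {R : RotationSystem G} {Y Y' : Set (ZigzagState G)}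

theorem symm_mem (h : R.IsZigzagUnion Y) (d : G.Dart) (b : Bool) :
    ((d.symm, b) : ZigzagState G) ∈ Y ↔ ((d, b) : ZigzagState G) ∈ Y :=
  h.rev_mem (d, b)

/-- Both states pass through the corner between `d` and `R.rot d`. -/
theorem rot_mem (h : R.IsZigzagUnion Y) (d : G.Dart) :
    ((R.rot d, false) : ZigzagState G) ∈ Y ↔ ((d, true) : ZigzagState G) ∈ Y := by
  rw [← h.symm_mem d, ← h.step_mem (d.symm, true), step_true, SimpleGraph.Dart.symm_symm]

theorem pow_mem (h : R.IsZigzagUnion Y) (x : ZigzagState G) (j : ℕ) :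
    (R.step ^ j) x ∈ Y ↔ x ∈ Y := by
  induction j with
  | zero => simp
  | succ j ih => rw [pow_succ', Equiv.Perm.mul_apply, h.step_mem, ih]

theorem compl (h : R.IsZigzagUnion Y) : R.IsZigzagUnion Yᶜ :=
  ⟨fun x => not_congr (h.step_mem x), fun x => not_congr (h.rev_mem x)⟩

theorem union (h : R.IsZigzagUnion Y) (h' : R.IsZigzagUnion Y') : R.IsZigzagUnion (Y ∪ Y') :=
  ⟨fun x => or_congr (h.step_mem x) (h'.step_mem x), fun x => or_congr (h.rev_mem x) (h'.rev_mem x)⟩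

theorem zigzagOf_subset (h : R.IsZigzagUnion Y) {x : ZigzagState G} (hx : x ∈ Y) :
    R.zigzagOf x ⊆ Y := by
  have key : ∀ {y}, R.step.SameCycle x y → y ∈ Y := fun hy =>
    (hy.apply_eq_of_invariant (fun x => x ∈ Y) fun x => propext (h.step_mem x)).mp hx
  rintro y (hy | hy)
  · exact key hy
  · exact (h.rev_mem y).1 (key hy)

theorem edge_mem_iff (h : R.IsZigzagUnion Y) {d : G.Dart} :
    d.edge ∈ zigzagEdges Y ↔ ∃ b, ((d, b) : ZigzagState G) ∈ Y := by
  constructor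
  · rintro ⟨⟨d', b⟩, hx, he⟩
    rcases (SimpleGraph.dart_edge_eq_iff _ _).1 he with rfl | rfl
    · exact ⟨b, hx⟩
    · exact ⟨b, (h.symm_mem _ _).1 hx⟩
  · rintro ⟨b, hb⟩
    exact ⟨_, hb, rfl⟩

end IsZigzagUnion

theorem isZigzagUnion_zigzagOf (R : RotationSystem G) (x : ZigzagState G) :
    R.IsZigzagUnion (R.zigzagOf x) where
  step_mem y := by
    simp only [zigzagOf, Set.mem_ofPred_eq, Equiv.Perm.sameCycle_apply_right]
    rw [← Equiv.Perm.sameCycle_apply_right (y := (R.step y).rev), step_rev_step]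
  rev_mem y := by
    simp only [zigzagOf, Set.mem_ofPred_eq, ZigzagState.rev_rev]
    exact or_comm

theorem mem_zigzagOf_self (R : RotationSystem G) (x : ZigzagState G) : x ∈ R.zigzagOf x :=
  Or.inl (Equiv.Perm.SameCycle.refl _ _)

theorem IsZigzag.isZigzagUnion {R : RotationSystem G} {Z : Set (ZigzagState G)}
    (hZ : R.IsZigzag Z) : R.IsZigzagUnion Z := by
  obtain ⟨x, rfl⟩ := hZ
  exact R.isZigzagUnion_zigzagOf x

/-- A union of zigzags that meets a zigzag contains it. -/
theorem IsZigzag.subset {R : RotationSystem G} {Z Y : Set (ZigzagState G)} (hZ : R.IsZigzag Z)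
    (hY : R.IsZigzagUnion Y) {x : ZigzagState G} (hx : x ∈ Z) (hxY : x ∈ Y) : Z ⊆ Y := by
  obtain ⟨z, rfl⟩ := hZ
  refine hY.zigzagOf_subset ?_
  -- The complement of a union of zigzags is again one, and would contain the whole zigzag of `z`.
  by_contra hz
  exact hY.compl.zigzagOf_subset hz hx hxY

theorem IsZigzag.eq_of_mem {R : RotationSystem G} {Z Z' : Set (ZigzagState G)}
    (hZ : R.IsZigzag Z) (hZ' : R.IsZigzag Z') {x : ZigzagState G} (hx : x ∈ Z) (hx' : x ∈ Z') :
    Z = Z' :=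
  (hZ.subset hZ'.isZigzagUnion hx hx').antisymm (hZ'.subset hZ.isZigzagUnion hx' hx)

/-- The two passages through an edge differ in the Boolean, which reversal preserves. -/
theorem not_mem_of_simple {Z : Set (ZigzagState G)} (hs : IsSimpleZigzag Z)
    {d : G.Dart} {b : Bool} (h : ((d, b) : ZigzagState G) ∈ Z) :
    ((d, !b) : ZigzagState G) ∉ Z := by
  intro h'
  rcases hs _ h _ h' rfl with h | h <;> simpa [ZigzagState.rev] using congrArg Prod.snd h

open scoped Classical in
/-- On a plane drawing, the edges of a simple zigzag form a cut. -/
theorem exists_cut [Finite V] (R : RotationSystem G) (hR : R.IsPlane) {Z : Set (ZigzagState G)}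
    (hZ : R.IsZigzagUnion Z) (hs : IsSimpleZigzag Z) :
    ∃ c : V → ZMod 2, ∀ d : G.Dart, c d.snd = c d.fst + if d.edge ∈ zigzagEdges Z then 1 else 0 := by
  have := Fintype.ofFinite G.Dart
  obtain ⟨c, hc⟩ := R.exists_potential hR (fun e => if e ∈ zigzagEdges Z then 1 else 0) (by
    intro f
    -- Simplicity excludes both passages at once, so the indicator of the edges is a function on
    -- darts plus its shift by `facePerm`; the sum around a face is then twice another sum.
    have h1 : ∀ d : G.Dart, (if d.edge ∈ zigzagEdges Z then (1 : ZMod 2) else 0) =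
        (if ((d, false) : ZigzagState G) ∈ Z then 1 else 0) +
          if ((R.facePerm d, false) : ZigzagState G) ∈ Z then 1 else 0 := by
      intro d
      rw [facePerm_apply, hZ.rot_mem, hZ.symm_mem]
      simp only [hZ.edge_mem_iff, Bool.exists_bool]
      by_cases h : ((d, false) : ZigzagState G) ∈ Z
      · simp [h, show ((d, true) : ZigzagState G) ∉ Z from
          not_mem_of_simple hs h]
      · simp [h]
    have h2 := R.sum_face_facePerm f
      (fun d => if ((d, false) : ZigzagState G) ∈ Z then (1 : ZMod 2) else 0)
    simp only [h1, ← Finset.sum_filter, Finset.sum_add_distrib] at h2 ⊢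
    rw [h2, CharTwo.add_self_eq_zero])
  refine ⟨c, fun d => ?_⟩
  rw [← hc d, ← add_assoc, CharTwo.add_self_eq_zero, zero_add]

/-- Between consecutive edges in common with a simple zigzag, a left-right walk makes an odd number
of steps. -/
theorem snd_eq_not_of_isNextIn [Finite V] {R : RotationSystem G} (hR : R.IsPlane)
    {color : V → ZMod 2} (hcolor : ∀ d : G.Dart, color d.snd = color d.fst + 1)
    {Z Z' : Set (ZigzagState G)} (hZ : R.IsZigzagUnion Z) (hZ' : R.IsZigzag Z')
    (hs' : IsSimpleZigzag Z') {x y : ZigzagState G} (hx : x ∈ Z) (hxe : x.edge ∈ zigzagEdges Z')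
    (hxy : R.IsNextIn (zigzagEdges Z ∩ zigzagEdges Z') x y) : y.2 = !x.2 := by
  classical
  obtain ⟨c, hc⟩ := R.exists_cut hR hZ'.isZigzagUnion hs'
  obtain ⟨m, hm, hmy, hye, hmin⟩ := hxy
  have hflip : ∀ d : G.Dart, d.edge ∈ zigzagEdges Z' → c d.snd = c d.fst + 1 := by
    intro d hd
    simpa [hd] using hc d
  -- Each edge of `Z'` switches both `c` and `color`, so the states sharing a value of the sum form
  -- a union of zigzags, which must be all of `Z'`.
  have hconst : ∀ z ∈ Z', ∀ z' ∈ Z', c z.1.snd + color z.1.snd = c z'.1.snd + color z'.1.snd := by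
    have hone : (1 : ZMod 2) + 1 = 0 := rfl
    intro z hz z' hz'
    have hW : R.IsZigzagUnion
        {w | w ∈ Z' ∧ c z.1.snd + color z.1.snd = c w.1.snd + color w.1.snd} := by
      have hZu := hZ'.isZigzagUnion
      constructor
      · intro w
        simp only [Set.mem_ofPred_eq, hZu.step_mem]
        refine and_congr_right fun hw => ?_
        rw [hflip (R.step w).1 ⟨_, (hZu.step_mem w).2 hw, rfl⟩, hcolor (R.step w).1, R.step_fst,
          add_add_add_comm, hone, add_zero]
      · intro w
        simp only [Set.mem_ofPred_eq, hZu.rev_mem]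
        refine and_congr_right fun hw => ?_
        have h1 : w.rev.1.snd = w.1.fst := rfl
        rw [h1, hflip w.1 ⟨_, hw, rfl⟩, hcolor w.1, add_add_add_comm, hone, add_zero]
    exact (hZ'.subset hW hz ⟨hz, rfl⟩ hz').2
  have hconst' : ∀ z z' : ZigzagState G, z.edge ∈ zigzagEdges Z' → z'.edge ∈ zigzagEdges Z' →
      c z.1.snd + color z.1.snd = c z'.1.snd + color z'.1.snd := by
    rintro ⟨d, b⟩ ⟨d', b'⟩ h h'
    obtain ⟨b₁, h₁⟩ := hZ'.isZigzagUnion.edge_mem_iff.1 h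
    obtain ⟨b₂, h₂⟩ := hZ'.isZigzagUnion.edge_mem_iff.1 h'
    exact hconst (d, b₁) h₁ (d', b₂) h₂
  -- Before `y` the arc uses no edge of `Z'`, so it does not cross the cut; the edge of `y` does.
  have hpath : ∀ j, j < m → c ((R.step ^ j) x).1.snd = c x.1.snd := by
    intro j
    induction j with
    | zero => simp
    | succ j ih =>
      intro hj
      have h1 := hmin (j + 1) j.succ_pos hj
      have h2 : ((R.step ^ (j + 1)) x).1.edge ∉ zigzagEdges Z' := fun h =>
        h1 ⟨⟨_, (hZ.pow_mem x _).2 hx, rfl⟩, h⟩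
      rw [hc, if_neg h2, add_zero, pow_succ', Equiv.Perm.mul_apply, R.step_fst, ih (by omega)]
  have hlast : c y.1.snd = c x.1.snd + 1 := by
    rw [hflip y.1 hye.2, ← hpath (m - 1) (by omega), ← hmy]
    obtain ⟨m, rfl⟩ : ∃ k, m = k + 1 := ⟨m - 1, by omega⟩
    rw [pow_succ', Equiv.Perm.mul_apply, R.step_fst, Nat.add_sub_cancel]
  -- Colour and turn both switch at every step.
  have hpar : color y.1.snd + (if y.2 then 1 else 0) = color x.1.snd + if x.2 then 1 else 0 := by
    rw [← hmy]
    clear hmy hmin hm hpath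
    induction m with
    | zero => simp
    | succ m ih =>
      rw [← ih, pow_succ', Equiv.Perm.mul_apply, hcolor, R.step_fst, R.step_snd, add_assoc]
      congr 1
      cases ((R.step ^ m) x).2 <;> decide
  have hfin := hconst' x y hxe hye.2
  rw [hlast] at hfin
  generalize c x.1.snd = a at *
  generalize color x.1.snd = p at *
  generalize color y.1.snd = q at *
  generalize x.2 = s at *
  generalize y.2 = t at *
  clear hlast hconst hconst' hflip hc hmin hpath hmy
  revert a p q s t
  decide

/-- On a bipartite drawing, a left-right walk never passes an edge again in the opposite direction
with the same turn. -/
theorem not_sameCycle_rev {R : RotationSystem G}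
    {color : V → ZMod 2} (hcolor : ∀ d : G.Dart, color d.snd = color d.fst + 1)
    (x : ZigzagState G) : ¬ R.step.SameCycle x x.rev := by
  intro h
  have h1 := h.apply_eq_of_invariant
    (fun x => color x.1.snd + (if x.2 then 1 else 0)) (by
      intro x
      rw [hcolor, R.step_fst, R.step_snd, add_assoc]
      congr 1
      cases x.2 <;> decide)
  have h2 : x.rev.1.snd = x.1.fst := rfl
  have h3 : x.rev.2 = x.2 := rfl
  simp only [h2, h3, hcolor] at h1
  simp at h1

/-! ### Regions and their Euler characteristic. -/

/-- A vertex and a face touch, relative to a union of zigzags, if they share a corner that no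
zigzag passes through. The corner that precedes the dart `d` at its first end is passed
by the zigzags through the state `(d, false)`. -/
def Touch (R : RotationSystem G) (Y : Set (ZigzagState G)) (a b : V ⊕ R.Face) : Prop :=
  ∃ d : G.Dart, ((d, false) : ZigzagState G) ∉ Y ∧ a = Sum.inl d.fst ∧ b = Sum.inr (R.face d)

/-- The regions into which the zigzags of `Y` divide the sphere. -/
def Region (R : RotationSystem G) (Y : Set (ZigzagState G)) : Type _ :=
  Quot (R.Touch Y)

/-- The region of a vertex. -/
def vertexRegion (R : RotationSystem G) (Y : Set (ZigzagState G)) (v : V) : R.Region Y :=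
  Quot.mk _ (Sum.inl v)

/-- The region of the face to which a dart belongs. -/
def faceRegion (R : RotationSystem G) (Y : Set (ZigzagState G)) (f : R.Face) : R.Region Y :=
  Quot.mk _ (Sum.inr f)

variable {R : RotationSystem G} {Y : Set (ZigzagState G)}

theorem vertexRegion_eq {d : G.Dart} (h : ((d, false) : ZigzagState G) ∉ Y) :
    R.vertexRegion Y d.fst = R.faceRegion Y (R.face d) :=
  Quot.sound ⟨d, h, rfl, rfl⟩

theorem vertexRegion_eq' (hY : R.IsZigzagUnion Y) {d : G.Dart}
    (h : ((d, true) : ZigzagState G) ∉ Y) :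
    R.vertexRegion Y d.fst = R.faceRegion Y (R.face d.symm) := by
  rw [← R.rot_fst, vertexRegion_eq (mt (hY.rot_mem d).1 h), face_rot]

/-- A function of vertices and faces that agrees at the free corners inside a region is constant
on the region. -/
theorem eq_of_touch {X : Type*} [Zero X] (r : R.Region Y)
    (φ : {a : V ⊕ R.Face // (Quot.mk _ a : R.Region Y) = r} → X)
    (h : ∀ a b, R.Touch Y a.1 b.1 → φ a = φ b) (a b) : φ a = φ b := by
  classical
  -- The extension by zero descends to the quotient; no corner joins the region to its outside, so
  -- the value there is immaterial.
  let ψ : V ⊕ R.Face → X := fun a =>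
    if ha : (Quot.mk _ a : R.Region Y) = r then φ ⟨a, ha⟩ else 0
  have hψ : ∀ a b, R.Touch Y a b → ψ a = ψ b := by
    intro a b hab
    have hq : (Quot.mk _ a : R.Region Y) = Quot.mk _ b := Quot.sound hab
    by_cases ha : (Quot.mk _ a : R.Region Y) = r
    · have h1 : ψ a = φ ⟨a, ha⟩ := dif_pos ha
      have h2 : ψ b = φ ⟨b, hq.symm.trans ha⟩ := dif_pos (hq.symm.trans ha)
      rw [h1, h2]
      exact h _ _ hab
    · simp only [ψ, ha, show ¬ (Quot.mk _ b : R.Region Y) = r from hq ▸ ha, dif_neg,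
        not_false_iff]
  have h1 : ∀ a : {a : V ⊕ R.Face // (Quot.mk _ a : R.Region Y) = r}, φ a = Quot.lift ψ hψ r := by
    rintro ⟨a, rfl⟩
    simp [ψ]
  rw [h1, h1]

/-- The midpoint of the edge of `d` lies inside the region `r`. -/
def IsInnerDart (R : RotationSystem G) {Y : Set (ZigzagState G)} (r : R.Region Y) (d : G.Dart) :
    Prop :=
  ((d, false) : ZigzagState G) ∉ Y ∧ ((d, true) : ZigzagState G) ∉ Y ∧ R.vertexRegion Y d.fst = r

/-- Both ends of an uncut edge touch the face of `d.symm`. -/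
theorem IsInnerDart.symm (hY : R.IsZigzagUnion Y) {r : R.Region Y} {d : G.Dart}
    (h : R.IsInnerDart r d) : R.IsInnerDart r d.symm := by
  refine ⟨by simpa [hY.symm_mem] using h.1, by simpa [hY.symm_mem] using h.2.1, ?_⟩
  rw [← h.2.2, vertexRegion_eq (d := d.symm) (by simpa [hY.symm_mem] using h.1),
    vertexRegion_eq' hY h.2.1]

/-- The corner before `d` lies inside the region `r`. -/
def IsInnerCorner (R : RotationSystem G) {Y : Set (ZigzagState G)} (r : R.Region Y) (d : G.Dart) :
    Prop :=
  ((d, false) : ZigzagState G) ∉ Y ∧ R.vertexRegion Y d.fst = r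

theorem IsInnerDart.corner {r : R.Region Y} {d : G.Dart}
    (h : R.IsInnerDart r d) : R.IsInnerCorner r d := ⟨h.1, h.2.2⟩

theorem IsInnerDart.corner_rot (hY : R.IsZigzagUnion Y) {r : R.Region Y} {d : G.Dart}
    (h : R.IsInnerDart r d) : R.IsInnerCorner r (R.rot d) :=
  ⟨mt (hY.rot_mem d).1 h.2.1, by rw [R.rot_fst]; exact h.2.2⟩

open scoped Classical in
/-- The Euler characteristic of a region is at most one. -/
theorem euler_region_le [Fintype V] [Fintype G.Dart] [Fintype R.Face] (hG : G.Connected)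
    (hY : R.IsZigzagUnion Y) (hne : Y.Nonempty) (r : R.Region Y) :
    2 * Fintype.card {a : V ⊕ R.Face // (Quot.mk _ a : R.Region Y) = r} +
        (Finset.univ.filter fun d => R.IsInnerDart r d).card ≤
      2 * (Finset.univ.filter fun d => R.IsInnerCorner r d).card + 2 := by
  -- A cell structure on the region: the points are vertices and faces, the segments are uncut
  -- corners joining a vertex to a face, and the squares are uncut edges, each bounded by the four
  -- corners around it. `A` and `B` are the boundary maps modulo two.
  let S := {a : V ⊕ R.Face // (Quot.mk _ a : R.Region Y) = r}
  let E := {d : G.Dart // R.IsInnerCorner r d}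
  let W := {e : Sym2 V // ∃ d : G.Dart, d.edge = e ∧ R.IsInnerDart r d}
  have hinner : ∀ (w : W) (d : G.Dart), d.edge = w.1 → R.IsInnerDart r d := by
    rintro ⟨_, d', rfl, h⟩ d hd
    rcases (SimpleGraph.dart_edge_eq_iff _ _).1 hd with rfl | rfl
    · exact h
    · exact h.symm hY
  let A : Matrix W E (ZMod 2) := fun w c =>
    (if c.1.edge = w.1 then 1 else 0) + if (R.rot.symm c.1).edge = w.1 then 1 else 0
  let t : G.Dart → S → ZMod 2 := fun d a => if a.1 = Sum.inr (R.face d) then 1 else 0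
  let h : G.Dart → S → ZMod 2 := fun d a => (if a.1 = Sum.inl d.fst then 1 else 0) + t d a
  let B : Matrix E S (ZMod 2) := fun c a => h c.1 a
  have hAB : A * B = 0 := by
    ext w a
    let g : G.Dart → ZMod 2 := fun c => ((if c.edge = w.1 then 1 else 0) +
        if (R.rot.symm c).edge = w.1 then 1 else 0) * h c a
    have h1 : (A * B) w a = ∑ c : G.Dart, g c := by
      calc (A * B) w a = ∑ c : E, g c.1 := rfl
        _ = ∑ c with R.IsInnerCorner r c, g c := (Finset.sum_subtype _ (by simp) g).symm
        -- The four corners around an inner edge are inner, so the other corners contribute nothing.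
        _ = ∑ c, g c := Finset.sum_filter_of_ne fun c _ hc => by
          by_contra hc'
          refine hc ?_
          have h2 : c.edge ≠ w.1 := fun he => hc' (hinner w c he).corner
          have h3 : (R.rot.symm c).edge ≠ w.1 := fun he => hc' (by
            simpa using (hinner w _ he).corner_rot hY)
          simp [g, h2, h3]
    have h2 : ∑ c : G.Dart, g c =
        ∑ c : G.Dart, if c.edge = w.1 then h c a + h (R.rot c) a else 0 := by
      have h3 := Equiv.sum_comp R.rot
        fun c => if (R.rot.symm c).edge = w.1 then h c a else 0
      simp only [Equiv.symm_apply_apply] at h3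
      simp only [g, add_mul, ite_mul, one_mul, zero_mul, Finset.sum_add_distrib, ← h3,
        ← Finset.sum_filter]
    obtain ⟨d, hd, -⟩ := w.2
    rw [h1, h2, ← hd, G.sum_dart_edge]
    simp only [h, t, face_rot, R.rot_fst, SimpleGraph.Dart.symm_symm, Matrix.zero_apply]
    generalize (if a.1 = Sum.inl d.fst then (1 : ZMod 2) else 0) = p
    generalize (if a.1 = Sum.inl d.symm.fst then (1 : ZMod 2) else 0) = p'
    generalize (if a.1 = Sum.inr (R.face d) then (1 : ZMod 2) else 0) = q
    generalize (if a.1 = Sum.inr (R.face d.symm) then (1 : ZMod 2) else 0) = q'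
    revert p p' q q'
    decide
  -- The boundaries of the squares are independent: a relation, extended by zero, is constant around
  -- each vertex, hence on the connected graph, and it vanishes on an edge of the nonempty `Y`.
  have hA : Fintype.card W ≤ A.rank := by
    rw [← Matrix.rank_transpose, Matrix.rank, LinearMap.finrank_range_of_inj,
      Module.finrank_fintype_fun_eq_card]
    refine (injective_iff_map_eq_zero _).2 fun ψ hψ => ?_
    let ψ' : Sym2 V → ZMod 2 := fun e =>
      if he : ∃ d : G.Dart, d.edge = e ∧ R.IsInnerDart r d then ψ ⟨e, he⟩ else 0
    have h0 : ∀ e, ∑ w : W, (if e = w.1 then 1 else 0) * ψ w = ψ' e := by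
      intro e
      by_cases he : ∃ d : G.Dart, d.edge = e ∧ R.IsInnerDart r d
      · rw [Finset.sum_eq_single ⟨e, he⟩]
        · simp [ψ', he]
        · intro w _ hw
          have : e ≠ w.1 := fun h => hw (Subtype.ext h.symm)
          simp [this]
        · simp
      · simp only [ψ', he, dif_neg, not_false_iff]
        refine Finset.sum_eq_zero fun w _ => ?_
        have : e ≠ w.1 := fun h => he (h ▸ w.2)
        simp [this]
    have h1 : ∀ c, R.IsInnerCorner r c → ψ' (R.rot.symm c).edge = ψ' c.edge := by
      intro c hc
      have h2 : (Aᵀ *ᵥ ψ) ⟨c, hc⟩ = ψ' c.edge + ψ' (R.rot.symm c).edge := by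
        rw [← h0, ← h0, ← Finset.sum_add_distrib]
        exact Finset.sum_congr rfl fun w _ => add_mul _ _ _
      exact (ZMod.eq_of_add_eq_zero (h2.symm.trans (congrFun hψ ⟨c, hc⟩))).symm
    have hzero : ∀ d : G.Dart, ¬ R.IsInnerDart r d → ψ' d.edge = 0 := by
      intro d hd
      exact dif_neg fun ⟨d', he, h⟩ => hd (hinner ⟨_, d', rfl, h⟩ d he.symm)
    have hrot : ∀ d : G.Dart, ψ' (R.rot d).edge = ψ' d.edge := by
      intro d
      by_cases hd : R.IsInnerDart r d
      · simpa using (h1 _ (hd.corner_rot hY)).symm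
      · by_cases hd' : R.IsInnerDart r (R.rot d)
        · simpa using (h1 _ hd'.corner).symm
        · rw [hzero _ hd, hzero _ hd']
    obtain ⟨⟨d₀, b⟩, hd₀⟩ := hne
    have hd₀' : ¬ R.IsInnerDart r d₀ := by
      rintro ⟨h2, h3, -⟩
      cases b
      exacts [h2 hd₀, h3 hd₀]
    ext w
    obtain ⟨d, hd, -⟩ := id w.2
    have h4 := R.eq_of_rot_of_symm hG (fun d => ψ' d.edge) hrot (by simp) d d₀
    have h5 : ψ' w.1 = ψ w := dif_pos w.2
    rw [← h5, ← hd, h4, hzero _ hd₀']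
    rfl
  -- A region is connected, so only constants have zero coboundary.
  have hB : Fintype.card S ≤ B.rank + 1 := by
    refine Matrix.card_le_rank_add_one _ fun φ hφ => eq_of_touch r φ ?_
    rintro ⟨a, ha⟩ ⟨b, hb⟩ ⟨d, hd, rfl, rfl⟩
    have h2 : (B *ᵥ φ) ⟨d, hd, ha⟩ = φ ⟨_, ha⟩ + φ ⟨_, hb⟩ := by
      have h3 : ∀ x : S, ∑ a : S, (if a.1 = x.1 then 1 else 0) * φ a = φ x := by
        intro x
        rw [Finset.sum_eq_single x (fun a _ ha => by simp [Subtype.ext_iff.not.1 ha]) (by simp)]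
        simp
      rw [← h3 ⟨_, ha⟩, ← h3 ⟨_, hb⟩, ← Finset.sum_add_distrib]
      exact Finset.sum_congr rfl fun w _ => add_mul _ _ _
    exact ZMod.eq_of_add_eq_zero (h2.symm.trans (congrFun hφ ⟨d, hd, ha⟩))
  have hW : (Finset.univ.filter fun d => R.IsInnerDart r d).card = 2 * Fintype.card W := by
    rw [Fintype.card_subtype, Finset.card_eq_sum_card_fiberwise (f := SimpleGraph.Dart.edge)
      (t := Finset.univ.filter fun e => ∃ d : G.Dart, d.edge = e ∧ R.IsInnerDart r d)
      (fun d hd => by simpa using ⟨d, rfl, by simpa using hd⟩), mul_comm, ← smul_eq_mul]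
    refine Finset.sum_const_nat fun e he => ?_
    obtain ⟨d, rfl, hd⟩ := (Finset.mem_filter.1 he).2
    rw [← Finset.card_pair d.symm_ne.symm]
    congr 1
    ext d'
    simp only [Finset.mem_filter, Finset.mem_univ, true_and, Finset.mem_insert,
      Finset.mem_singleton, SimpleGraph.dart_edge_eq_iff]
    refine and_iff_right_of_imp ?_
    rintro (rfl | rfl)
    exacts [hd, hd.symm hY]
  have hE : Fintype.card E = (Finset.univ.filter fun d => R.IsInnerCorner r d).card :=
    Fintype.card_subtype _
  have h6 : Fintype.card S = Fintype.card {a : V ⊕ R.Face // (Quot.mk _ a : R.Region Y) = r} := rfl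
  have := Matrix.rank_add_rank_le_card_of_mul_eq_zero hAB
  omega

/-! ### The Gauss-Bonnet bound. -/

open scoped Classical in
/-- Gauss-Bonnet bound for the acute corners (at vertices) and the obtuse corners (on faces) of a
region. -/
theorem region_corners_le [Fintype V] [Fintype G.Dart] [Fintype R.Face] (hG : G.Connected)
    (hcubic : ∀ v, (G.neighborSet v).ncard = 3) (hfaces : ∀ d, R.faceSize d ≤ 6)
    (hY : R.IsZigzagUnion Y) (hne : Y.Nonempty) (r : R.Region Y) :
    2 * (Finset.univ.filter fun d : G.Dart => (((d, false) : ZigzagState G) ∈ Y ∧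
        ((d, true) : ZigzagState G) ∈ Y) ∧ R.vertexRegion Y d.fst = r).card +
      (Finset.univ.filter fun d : G.Dart => (((d, false) : ZigzagState G) ∈ Y ∧
        ((d, true) : ZigzagState G) ∈ Y) ∧ R.faceRegion Y (R.face d) = r).card ≤ 6 := by
  -- `p` and `q` tell whether the vertex and the face of the dart lie in the region; `k` and `l`
  -- tell which of the two passages through its edge are made.
  let p : G.Dart → ℤ := fun d => if R.vertexRegion Y d.fst = r then 1 else 0
  let q : G.Dart → ℤ := fun d => if R.faceRegion Y (R.face d) = r then 1 else 0
  let k : G.Dart → ℤ := fun d => if ((d, false) : ZigzagState G) ∈ Y then 1 else 0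
  let l : G.Dart → ℤ := fun d => if ((d, true) : ZigzagState G) ∈ Y then 1 else 0
  have hk : ∀ d, k d.symm = k d := fun d => by simp only [k, hY.symm_mem]
  have hl : ∀ d, l d.symm = l d := fun d => by simp only [l, hY.symm_mem]
  have hkr : ∀ d, k (R.rot d) = l d := fun d => by simp only [k, l, hY.rot_mem]
  have hpr : ∀ d, p (R.rot d) = p d := fun d => by simp only [p, R.rot_fst]
  have hqf : ∀ d, q (R.rot d) = q d.symm := fun d => by simp only [q, face_rot]
  have hpq : ∀ d, k d = 0 → p d = q d := by
    intro d h
    have : ((d, false) : ZigzagState G) ∉ Y := by simpa [k] using h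
    simp only [p, q, vertexRegion_eq this]
  have hpq' : ∀ d, l d = 0 → p d = q d.symm := by
    intro d h
    have : ((d, true) : ZigzagState G) ∉ Y := by simpa [l] using h
    simp only [p, q, vertexRegion_eq' hY this]
  have hk01 : ∀ d, k d = 0 ∨ k d = 1 := fun d => by simp only [k]; split_ifs <;> simp
  have hl01 : ∀ d, l d = 0 ∨ l d = 1 := fun d => by simp only [l]; split_ifs <;> simp
  -- The uncut corners are counted in four equal ways, with weight `1 - k` or `1 - l`, from the
  -- vertices or from the faces.
  have hE1 : ((Finset.univ.filter fun d => R.IsInnerCorner r d).card : ℤ) =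
      ∑ d, (1 - k d) * p d := by
    rw [Finset.card_filter]
    push_cast
    refine Finset.sum_congr rfl fun d _ => ?_
    by_cases h1 : ((d, false) : ZigzagState G) ∈ Y <;> simp [IsInnerCorner, k, p, h1]
  have hE2 : ∑ d, (1 - k d) * p d = ∑ d, (1 - l d) * p d := by
    rw [← Equiv.sum_comp R.rot]
    simp only [hkr, hpr]
  have hE3 : ∑ d, (1 - k d) * p d = ∑ d, (1 - k d) * q d := by
    refine Finset.sum_congr rfl fun d _ => ?_
    rcases hk01 d with h | h
    · rw [hpq d h]
    · simp [h]
  have hE4 : ∑ d, (1 - k d) * q d = ∑ d, (1 - l d) * q d := by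
    rw [← Equiv.sum_comp R.facePerm]
    simp only [facePerm_apply, hkr, hqf, hl, SimpleGraph.Dart.symm_symm]
  have hI : ((Finset.univ.filter fun d => R.IsInnerDart r d).card : ℤ) =
      ∑ d, (1 - k d) * (1 - l d) * p d := by
    rw [Finset.card_filter]
    push_cast
    refine Finset.sum_congr rfl fun d _ => ?_
    by_cases h1 : ((d, false) : ZigzagState G) ∈ Y <;>
      by_cases h2 : ((d, true) : ZigzagState G) ∈ Y <;> simp [IsInnerDart, k, l, p, h1, h2]
  have hS : Fintype.card {a : V ⊕ R.Face // (Quot.mk _ a : R.Region Y) = r} =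
      (Finset.univ.filter fun v => R.vertexRegion Y v = r).card +
        (Finset.univ.filter fun f => R.faceRegion Y f = r).card := by
    rw [Fintype.card_subtype, Finset.card_filter, Fintype.sum_sum_type, Finset.card_filter,
      Finset.card_filter]
    rfl
  have hV : 3 * ((Finset.univ.filter fun v => R.vertexRegion Y v = r).card : ℤ) = ∑ d, p d := by
    have h1 : (Finset.univ.filter fun d : G.Dart => R.vertexRegion Y d.fst = r).card =
        (Finset.univ.filter fun v => R.vertexRegion Y v = r).card * 3 := by
      rw [Finset.card_eq_sum_card_fiberwise (f := fun d : G.Dart => d.fst)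
        (t := Finset.univ.filter fun v => R.vertexRegion Y v = r)
        (fun d hd => by simpa using hd)]
      refine Finset.sum_const_nat fun v hv => ?_
      rw [← hcubic v, Set.ncard_eq_toFinset_card', Set.toFinset_card,
        SimpleGraph.card_neighborSet_eq_degree, ← SimpleGraph.dart_fst_fiber_card_eq_degree]
      rw [Finset.filter_filter]
      congr 1
      ext d
      simp only [Finset.mem_filter, Finset.mem_univ, true_and]
      refine and_iff_right_of_imp ?_
      rintro rfl
      exact (Finset.mem_filter.1 hv).2
    simp only [p, Finset.sum_boole, h1]
    push_cast
    ring
  -- Apart from the Euler bound, this is the only inequality: positive curvature of the small faces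
  -- is discarded here.
  have hF : ∑ d, q d ≤ 6 * ((Finset.univ.filter fun f => R.faceRegion Y f = r).card : ℤ) := by
    have h1 : (Finset.univ.filter fun d : G.Dart => R.faceRegion Y (R.face d) = r).card ≤
        6 * (Finset.univ.filter fun f => R.faceRegion Y f = r).card := by
      rw [Finset.card_eq_sum_card_fiberwise (f := R.face)
        (t := Finset.univ.filter fun f => R.faceRegion Y f = r)
        (fun d hd => by simpa using hd), mul_comm, ← smul_eq_mul]
      refine Finset.sum_le_card_nsmul _ _ _ fun f hf => ?_
      obtain ⟨d, rfl⟩ := R.face_surjective f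
      refine le_trans (Finset.card_le_card ?_) ((R.card_face d).le.trans (hfaces d))
      exact Finset.filter_subset_filter _ (Finset.subset_univ _)
    simp only [q, Finset.sum_boole]
    exact_mod_cast h1
  have hC : ∀ P : G.Dart → Prop, ((Finset.univ.filter fun d : G.Dart =>
      (((d, false) : ZigzagState G) ∈ Y ∧ ((d, true) : ZigzagState G) ∈ Y) ∧ P d).card : ℤ) =
      ∑ d, k d * l d * if P d then 1 else 0 := by
    intro P
    rw [Finset.card_filter]
    push_cast
    refine Finset.sum_congr rfl fun d _ => ?_
    by_cases h1 : ((d, false) : ZigzagState G) ∈ Y <;>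
      by_cases h2 : ((d, true) : ZigzagState G) ∈ Y <;> simp [k, l, h1, h2]
  have heuler := euler_region_le hG hY hne r
  rw [hS] at heuler
  -- Six times the Euler bound, with 12|V| = 4 ∑ p, 12|F| ≥ 2 ∑ q and the twelvefold corner count
  -- split evenly among its four forms, less twice the quantity to be bounded. With this split the
  -- terms cancel edge by edge, between the two darts.
  let T : G.Dart → ℤ := fun d => 4 * p d + 2 * q d + 6 * ((1 - k d) * (1 - l d) * p d)
    - 3 * ((1 - k d) * p d) - 3 * ((1 - l d) * p d) - 3 * ((1 - k d) * q d)
    - 3 * ((1 - l d) * q d) - 4 * (k d * l d * p d) - 2 * (k d * l d * q d)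
  have hT : ∀ d, T d + T d.symm = 0 := by
    intro d
    have h1 := hpq d
    have h2 := hpq d.symm
    have h3 := hpq' d
    have h4 := hpq' d.symm
    simp only [hk, hl, SimpleGraph.Dart.symm_symm] at h2 h4
    simp only [T, hk, hl]
    rcases hk01 d with h | h <;> rcases hl01 d with h' | h' <;>
      simp [h, h'] at h1 h2 h3 h4 ⊢ <;> linarith
  have hTsum : ∑ d, T d = 0 := by
    have h1 : ∑ d : G.Dart, T d = ∑ d : G.Dart, T d.symm :=
      (Equiv.sum_comp (SimpleGraph.Dart.symm_involutive (G := G)).toPerm T).symm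
    have h2 : ∑ d, T d + ∑ d : G.Dart, T d.symm = 0 := by
      rw [← Finset.sum_add_distrib]
      exact Finset.sum_eq_zero fun d _ => hT d
    linarith
  simp only [T, Finset.sum_sub_distrib, Finset.sum_add_distrib, ← Finset.mul_sum] at hTsum
  have hCp := hC fun d => R.vertexRegion Y d.fst = r
  have hCq := hC fun d => R.faceRegion Y (R.face d) = r
  zify at heuler ⊢
  rw [hCp, hCq]
  rw [hE1, hI] at heuler
  change 2 * (∑ d, k d * l d * p d) + ∑ d, k d * l d * q d ≤ 6
  linarith

/-! ### Arcs between consecutive edges of a set. -/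

section Arcs

variable {C : Set (Sym2 V)} {x y y' : ZigzagState G}

theorem step_pow_rev_step_pow (R : RotationSystem G) (x : ZigzagState G) (j : ℕ) :
    (R.step ^ j) ((R.step ^ j) x).rev = x.rev := by
  induction j generalizing x with
  | zero => simp
  | succ j ih =>
    rw [pow_succ, Equiv.Perm.mul_apply, Equiv.Perm.mul_apply, ← Equiv.Perm.mul_apply,
      ← pow_succ, pow_succ', Equiv.Perm.mul_apply, ih, step_rev_step]

theorem IsNextIn.unique (h : R.IsNextIn C x y) (h' : R.IsNextIn C x y') : y = y' := by
  obtain ⟨m, hm, rfl, hC, hmin⟩ := h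
  obtain ⟨m', hm', rfl, hC', hmin'⟩ := h'
  rcases lt_trichotomy m m' with h | rfl | h
  · exact absurd hC (hmin' _ hm h)
  · rfl
  · exact absurd hC' (hmin _ hm' h)

theorem IsNextIn.rev (h : R.IsNextIn C x y) (hx : x.edge ∈ C) : R.IsNextIn C y.rev x.rev := by
  obtain ⟨m, hm, rfl, hC, hmin⟩ := h
  refine ⟨m, hm, R.step_pow_rev_step_pow x m, by simpa using hx, fun j hj hjm => ?_⟩
  have h1 := R.step_pow_rev_step_pow ((R.step ^ (m - j)) x) j
  rw [← Equiv.Perm.mul_apply (R.step ^ j) (R.step ^ (m - j)), ← pow_add,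
    Nat.add_sub_cancel' hjm.le] at h1
  rw [h1, ZigzagState.rev_edge]
  exact hmin _ (by omega) (by omega)

theorem IsNextIn.mem_iff {Y : Set (ZigzagState G)} (hY : R.IsZigzagUnion Y)
    (h : R.IsNextIn C x y) : y ∈ Y ↔ x ∈ Y := by
  obtain ⟨m, hm, rfl, -⟩ := h
  exact hY.pow_mem x m

theorem IsNextIn.sameCycle (h : R.IsNextIn C x y) : R.step.SameCycle x y := by
  obtain ⟨m, hm, rfl, -⟩ := h
  exact ⟨m, by simp⟩

theorem IsNextIn.edge_mem (h : R.IsNextIn C x y) : y.edge ∈ C := by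
  obtain ⟨m, hm, rfl, h, -⟩ := h
  exact h

theorem isNextIn_of_pow {j : ℕ} (hj : 0 < j) (h : ((R.step ^ j) x).edge ∈ C) :
    ∃ m, 0 < m ∧ m ≤ j ∧ R.IsNextIn C x ((R.step ^ m) x) := by
  classical
  have hex : ∃ m, 0 < m ∧ ((R.step ^ m) x).edge ∈ C := ⟨j, hj, h⟩
  refine ⟨Nat.find hex, (Nat.find_spec hex).1, Nat.find_min' hex ⟨hj, h⟩, Nat.find hex,
    (Nat.find_spec hex).1, rfl, (Nat.find_spec hex).2, fun i hi hlt hiC => ?_⟩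
  exact Nat.find_min hex hlt ⟨hi, hiC⟩

theorem exists_pow_step_eq_self [Finite V] (R : RotationSystem G) (x : ZigzagState G) :
    ∃ j, 0 < j ∧ (R.step ^ j) x = x :=
  ⟨orderOf R.step, orderOf_pos _, by rw [pow_orderOf_eq_one]; rfl⟩

theorem exists_isNextIn [Finite V] (hx : x.edge ∈ C) : ∃ y, R.IsNextIn C x y := by
  obtain ⟨j, hj, hjx⟩ := R.exists_pow_step_eq_self x
  obtain ⟨m, -, -, h⟩ := isNextIn_of_pow (C := C) hj (hjx.symm ▸ hx)
  exact ⟨_, h⟩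

open scoped Classical in
/-- The first state, after a given one, whose edge lies in `C`. -/
noncomputable def nextIn (R : RotationSystem G) (C : Set (Sym2 V)) (x : ZigzagState G) :
    ZigzagState G :=
  -- The default `x` is never reached when `V` is finite and the edge of `x` lies in `C`.
  if h : ∃ y, R.IsNextIn C x y then h.choose else x

theorem isNextIn_nextIn [Finite V] (hx : x.edge ∈ C) : R.IsNextIn C x (R.nextIn C x) := by
  have h : ∃ y, R.IsNextIn C x y := exists_isNextIn hx
  rw [nextIn, dif_pos h]
  exact h.choose_spec

theorem iterate_nextIn_edge_mem [Finite V] (hx : x.edge ∈ C) (i : ℕ) :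
    ((R.nextIn C)^[i] x).edge ∈ C := by
  induction i with
  | zero => exact hx
  | succ i ih =>
    rw [Function.iterate_succ_apply']
    exact (isNextIn_nextIn ih).edge_mem

theorem isNextIn_iterate [Finite V] (hx : x.edge ∈ C) (i : ℕ) :
    R.IsNextIn C ((R.nextIn C)^[i] x) ((R.nextIn C)^[i + 1] x) := by
  rw [Function.iterate_succ_apply']
  exact isNextIn_nextIn (iterate_nextIn_edge_mem hx i)

/-- Every return to `C` is an iterate of the first return. The positivity clause makes a return to
`x` a genuine period. -/
theorem exists_iterate_nextIn_eq [Finite V] (j : ℕ) :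
    ∀ x : ZigzagState G, x.edge ∈ C → ((R.step ^ j) x).edge ∈ C →
      ∃ i, (0 < j → 0 < i) ∧ (R.nextIn C)^[i] x = (R.step ^ j) x := by
  induction j using Nat.strong_induction_on with
  | _ j ih =>
    intro x hx hj
    rcases Nat.eq_zero_or_pos j with rfl | hpos
    · exact ⟨0, by simp, by simp⟩
    · obtain ⟨m, hm, hmj, h⟩ := isNextIn_of_pow hpos hj
      have h1 : (R.step ^ (j - m)) ((R.step ^ m) x) = (R.step ^ j) x := by
        rw [← Equiv.Perm.mul_apply, ← pow_add, Nat.sub_add_cancel hmj]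
      obtain ⟨i, -, hi⟩ := ih (j - m) (by omega) _ h.edge_mem (h1.symm ▸ hj)
      refine ⟨i + 1, fun _ => i.succ_pos, ?_⟩
      rw [Function.iterate_succ_apply, (isNextIn_nextIn hx).unique h, hi, h1]

end Arcs

/-! ### The regions along the sides of an arc. -/

section Sides

/-- Every second vertex of a left-right walk lies on the same side, and two such neighbours touch a
common face. The hypotheses say that the two corners involved are not cut. -/
theorem vertexRegion_two_steps (hY : R.IsZigzagUnion Y) {x : ZigzagState G}
    (hx : ((x.1, !x.2) : ZigzagState G) ∉ Y) (hx' : (((R.step x).1, x.2) : ZigzagState G) ∉ Y) :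
    R.vertexRegion Y (R.step x).1.snd = R.vertexRegion Y x.1.fst := by
  rcases x with ⟨d, b⟩
  cases b
  · rw [step_false] at hx' ⊢
    rw [vertexRegion_eq' hY hx]
    rw [← hY.symm_mem] at hx'
    refine (vertexRegion_eq hx').trans ?_
    rw [← face_rot, Equiv.apply_symm_apply]
  · rw [step_true] at hx' ⊢
    rw [vertexRegion_eq hx]
    rw [← hY.symm_mem] at hx'
    refine (vertexRegion_eq' hY hx').trans ?_
    rw [SimpleGraph.Dart.symm_symm, face_rot, SimpleGraph.Dart.symm_symm]

/-- Here the two faces touch the vertex between them. After a right turn they are the faces of the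
darts themselves; after a left turn they would be those of the reversed darts. -/
theorem faceRegion_two_steps (hY : R.IsZigzagUnion Y) {x : ZigzagState G} (hb : x.2 = false)
    (hx : ((x.1, !x.2) : ZigzagState G) ∉ Y) (hx' : (((R.step x).1, x.2) : ZigzagState G) ∉ Y) :
    R.faceRegion Y (R.face (R.step (R.step x)).1) = R.faceRegion Y (R.face x.1) := by
  rcases x with ⟨d, b⟩
  obtain rfl : b = false := hb
  rw [step_false] at hx' ⊢
  rw [step_true, face_rot, SimpleGraph.Dart.symm_symm, ← vertexRegion_eq hx', rot_symm_fst]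
  rw [← hY.symm_mem] at hx
  exact (vertexRegion_eq' hY hx).trans (by rw [SimpleGraph.Dart.symm_symm])

variable {C : Set (Sym2 V)} {x y : ZigzagState G}

theorem step_pow_two_mul_snd (R : RotationSystem G) (x : ZigzagState G) (j : ℕ) :
    ((R.step ^ (2 * j)) x).2 = x.2 := by
  induction j with
  | zero => simp
  | succ j ih =>
    change ((R.step ^ (2 * j + 1 + 1)) x).2 = x.2
    rw [pow_succ', Equiv.Perm.mul_apply, step_snd, pow_succ', Equiv.Perm.mul_apply, step_snd, ih,
      Bool.not_not]

theorem IsNextIn.exists_odd (h : R.IsNextIn C x y) (hb : y.2 = !x.2) :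
    ∃ j, (R.step ^ (2 * j + 1)) x = y ∧
      ∀ i, 0 < i → i < 2 * j + 1 → ((R.step ^ i) x).edge ∉ C := by
  obtain ⟨m, hm, rfl, -, hmin⟩ := h
  rcases Nat.even_or_odd' m with ⟨j, rfl | rfl⟩
  · rw [step_pow_two_mul_snd] at hb
    simp at hb
  · exact ⟨j, rfl, hmin⟩

/-- Along an arc that ends with the other turn, the vertices on one side lie in one region. -/
theorem IsNextIn.vertexRegion_eq (hY : R.IsZigzagUnion Y)
    (hC : ∀ z ∈ Y, z.edge ∉ C → ((z.1, !z.2) : ZigzagState G) ∉ Y) (hx : x ∈ Y)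
    (h : R.IsNextIn C x y) (hb : y.2 = !x.2) :
    R.vertexRegion Y y.1.fst = R.vertexRegion Y x.1.snd := by
  obtain ⟨j, rfl, hmin⟩ := h.exists_odd hb
  have hfree : ∀ i, 0 < i → i < 2 * j + 1 →
      ((((R.step ^ i) x).1, !((R.step ^ i) x).2) : ZigzagState G) ∉ Y := fun i hi hij =>
    hC _ ((hY.pow_mem x i).2 hx) (hmin i hi hij)
  clear hmin hb h
  induction j with
  | zero => simp
  | succ j ih =>
    have h1 := hfree (2 * j + 1) (by omega) (by omega)
    have h2 := hfree (2 * j + 1 + 1) (by omega) (by omega)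
    rw [pow_succ', Equiv.Perm.mul_apply, step_snd, Bool.not_not] at h2
    rw [← ih fun i hi hij => hfree i hi (by omega)]
    change R.vertexRegion Y ((R.step ^ (2 * j + 1 + 1 + 1)) x).1.fst = _
    rw [pow_succ' _ (2 * j + 1 + 1), pow_succ' _ (2 * j + 1), Equiv.Perm.mul_apply,
      Equiv.Perm.mul_apply]
    rw [step_fst]
    exact vertexRegion_two_steps hY h1 h2

/-- Along an arc that ends with the other turn, the faces on one side lie in one region. -/
theorem IsNextIn.faceRegion_eq (hY : R.IsZigzagUnion Y)
    (hC : ∀ z ∈ Y, z.edge ∉ C → ((z.1, !z.2) : ZigzagState G) ∉ Y) (hx : x ∈ Y)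
    (h : R.IsNextIn C x y) (hb : y.2 = !x.2) (hxb : x.2 = true) :
    R.faceRegion Y (R.face y.1) = R.faceRegion Y (R.face x.1) := by
  obtain ⟨j, rfl, hmin⟩ := h.exists_odd hb
  have hfree : ∀ i, 0 < i → i < 2 * j + 1 →
      ((((R.step ^ i) x).1, !((R.step ^ i) x).2) : ZigzagState G) ∉ Y := fun i hi hij =>
    hC _ ((hY.pow_mem x i).2 hx) (hmin i hi hij)
  clear hmin hb h
  induction j with
  | zero => 
    rcases x with ⟨d, b⟩
    obtain rfl : b = true := hxb
    simp [step_true]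
  | succ j ih =>
    have h1 := hfree (2 * j + 1) (by omega) (by omega)
    have h2 := hfree (2 * j + 1 + 1) (by omega) (by omega)
    rw [pow_succ', Equiv.Perm.mul_apply, step_snd, Bool.not_not] at h2
    rw [← ih fun i hi hij => hfree i hi (by omega)]
    change R.faceRegion Y (R.face ((R.step ^ (2 * j + 1 + 1 + 1)) x).1) = _
    rw [pow_succ' _ (2 * j + 1 + 1), pow_succ' _ (2 * j + 1), Equiv.Perm.mul_apply,
      Equiv.Perm.mul_apply]
    refine faceRegion_two_steps hY ?_ h1 h2
    rw [pow_succ', Equiv.Perm.mul_apply, step_snd, step_pow_two_mul_snd, hxb, Bool.not_true]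

end Sides

/-! ### Two simple zigzags and their acute digons. -/

/-- Two distinct simple zigzags. -/
structure IsSimplePair (R : RotationSystem G) (Z Z' : Set (ZigzagState G)) : Prop where
  left : R.IsZigzag Z
  right : R.IsZigzag Z'
  ne : Z ≠ Z'
  simple_left : IsSimpleZigzag Z
  simple_right : IsSimpleZigzag Z'

namespace IsSimplePair

variable {Z Z' : Set (ZigzagState G)}

theorem symm (h : R.IsSimplePair Z Z') : R.IsSimplePair Z' Z :=
  ⟨h.right, h.left, h.ne.symm, h.simple_right, h.simple_left⟩

theorem not_mem_right (h : R.IsSimplePair Z Z') {x : ZigzagState G} (hx : x ∈ Z) : x ∉ Z' :=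
  fun hx' => h.ne (h.left.eq_of_mem h.right hx hx')

theorem union (h : R.IsSimplePair Z Z') : R.IsZigzagUnion (Z ∪ Z') :=
  h.left.isZigzagUnion.union h.right.isZigzagUnion

/-- Distinct zigzags share no state, so at a common edge each makes one of the two passages. -/
theorem mem_right_iff (h : R.IsSimplePair Z Z') {d : G.Dart}
    (hd : d.edge ∈ zigzagEdges Z ∩ zigzagEdges Z') (b : Bool) :
    ((d, b) : ZigzagState G) ∈ Z' ↔ ((d, b) : ZigzagState G) ∉ Z := by
  obtain ⟨b₁, h₁⟩ := h.left.isZigzagUnion.edge_mem_iff.1 hd.1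
  obtain ⟨b₂, h₂⟩ := h.right.isZigzagUnion.edge_mem_iff.1 hd.2
  have hne : b₁ ≠ b₂ := by
    rintro rfl
    exact h.not_mem_right h₁ h₂
  obtain rfl : b₂ = !b₁ := by revert hne; cases b₁ <;> cases b₂ <;> simp
  rcases Bool.eq_or_eq_not b b₁ with rfl | rfl
  · exact iff_of_false (h.not_mem_right h₁) (not_not.2 h₁)
  · exact iff_of_true h₂ (h.symm.not_mem_right h₂)

theorem mem_not_iff (h : R.IsSimplePair Z Z') {d : G.Dart}
    (hd : d.edge ∈ zigzagEdges Z ∩ zigzagEdges Z') (b : Bool) :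
    ((d, !b) : ZigzagState G) ∈ Z ↔ ((d, b) : ZigzagState G) ∉ Z := by
  refine ⟨fun h1 h2 => not_mem_of_simple h.simple_left h2 h1, fun h1 => ?_⟩
  by_contra h2
  rw [← h.mem_right_iff hd] at h1 h2
  exact not_mem_of_simple h.simple_right h1 h2

theorem mem_union (h : R.IsSimplePair Z Z') {d : G.Dart}
    (hd : d.edge ∈ zigzagEdges Z ∩ zigzagEdges Z') (b : Bool) :
    ((d, b) : ZigzagState G) ∈ Z ∪ Z' := by
  by_cases h1 : ((d, b) : ZigzagState G) ∈ Z
  · exact Or.inl h1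
  · exact Or.inr ((h.mem_right_iff hd b).2 h1)

/-- Off the common edges only one passage is made, so the arcs meet nothing in their interior; the
side lemmas need this. -/
theorem not_mem_union (h : R.IsSimplePair Z Z') (z : ZigzagState G) (hz : z ∈ Z ∪ Z')
    (he : z.edge ∉ zigzagEdges Z ∩ zigzagEdges Z') : ((z.1, !z.2) : ZigzagState G) ∉ Z ∪ Z' := by
  rintro (h1 | h1) <;> rcases hz with h2 | h2
  · exact not_mem_of_simple h.simple_left h2 h1
  · exact he ⟨⟨_, h1, rfl⟩, ⟨_, h2, rfl⟩⟩
  · exact he ⟨⟨_, h2, rfl⟩, ⟨_, h1, rfl⟩⟩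
  · exact not_mem_of_simple h.simple_right h2 h1

/-- Every arc between consecutive common edges ends with the other turn. -/
theorem snd_eq_not [Finite V] (h : R.IsSimplePair Z Z') (hR : R.IsPlane) {color : V → ZMod 2}
    (hcolor : ∀ d : G.Dart, color d.snd = color d.fst + 1) {x y : ZigzagState G}
    (hx : x.edge ∈ zigzagEdges Z ∩ zigzagEdges Z')
    (hxy : R.IsNextIn (zigzagEdges Z ∩ zigzagEdges Z') x y) : y.2 = !x.2 := by
  rcases h.mem_union hx x.2 with h1 | h1
  · exact snd_eq_not_of_isNextIn hR hcolor h.left.isZigzagUnion h.right h.simple_right h1 hx.2 hxy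
  · rw [Set.inter_comm] at hxy
    exact snd_eq_not_of_isNextIn hR hcolor h.right.isZigzagUnion h.left h.simple_left h1 hx.1 hxy

theorem edge_mem_iff (h : R.IsSimplePair Z Z') {d : G.Dart} :
    (((d, false) : ZigzagState G) ∈ Z ∪ Z' ∧ ((d, true) : ZigzagState G) ∈ Z ∪ Z') ↔
      d.edge ∈ zigzagEdges Z ∩ zigzagEdges Z' := by
  refine ⟨fun h1 => ?_, fun hd => ⟨h.mem_union hd _, h.mem_union hd _⟩⟩
  by_contra hd
  exact h.not_mem_union _ h1.1 hd h1.2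

/-- A region has at most three acute corners. -/
theorem card_acute_le [Finite V] (h : R.IsSimplePair Z Z') (hG : G.Connected)
    (hcubic : ∀ v, (G.neighborSet v).ncard = 3) (hfaces : ∀ d, R.faceSize d ≤ 6)
    (r : R.Region (Z ∪ Z')) (A : Finset G.Dart)
    (hA : ∀ d ∈ A, d.edge ∈ zigzagEdges Z ∩ zigzagEdges Z' ∧ R.vertexRegion (Z ∪ Z') d.fst = r) :
    A.card ≤ 3 := by
  have := Fintype.ofFinite V
  have := Fintype.ofFinite G.Dart
  have := Fintype.ofFinite R.Face
  rcases A.eq_empty_or_nonempty with rfl | ⟨d, hd⟩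
  · simp
  · refine le_of_mul_le_mul_left ((Nat.mul_le_mul_left 2 (Finset.card_le_card ?_)).trans
      (le_of_add_le_left (region_corners_le hG hcubic hfaces h.union
        ⟨_, h.mem_union (hA d hd).1 true⟩ r))) (show 0 < 2 by decide)
    intro a ha
    simpa only [Finset.mem_filter, Finset.mem_univ, true_and, h.edge_mem_iff] using hA a ha

/-- A region has at most six obtuse corners. -/
theorem card_obtuse_le [Finite V] (h : R.IsSimplePair Z Z') (hG : G.Connected)
    (hcubic : ∀ v, (G.neighborSet v).ncard = 3) (hfaces : ∀ d, R.faceSize d ≤ 6)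
    (r : R.Region (Z ∪ Z')) (A : Finset G.Dart)
    (hA : ∀ d ∈ A, d.edge ∈ zigzagEdges Z ∩ zigzagEdges Z' ∧
      R.faceRegion (Z ∪ Z') (R.face d) = r) : A.card ≤ 6 := by
  have := Fintype.ofFinite V
  have := Fintype.ofFinite G.Dart
  have := Fintype.ofFinite R.Face
  rcases A.eq_empty_or_nonempty with rfl | ⟨d, hd⟩
  · simp
  · refine (Finset.card_le_card ?_).trans
      (le_of_add_le_right (region_corners_le hG hcubic hfaces h.union
        ⟨_, h.mem_union (hA d hd).1 true⟩ r))
    intro a ha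
    simpa only [Finset.mem_filter, Finset.mem_univ, true_and, h.edge_mem_iff] using hA a ha

/-- The two zigzags that part at the head of a common edge meet again at their next common
edge. -/
theorem acuteDigon [Finite V] (h : R.IsSimplePair Z Z') (hR : R.IsPlane)
    (hcubic : ∀ v, (G.neighborSet v).ncard = 3) (hfaces : ∀ d, R.faceSize d ≤ 6)
    {color : V → ZMod 2} (hcolor : ∀ d : G.Dart, color d.snd = color d.fst + 1)
    {x y : ZigzagState G} (hx : x.edge ∈ zigzagEdges Z ∩ zigzagEdges Z')
    (hxy : R.IsNextIn (zigzagEdges Z ∩ zigzagEdges Z') x y) :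
    R.AcuteDigon (zigzagEdges Z ∩ zigzagEdges Z') x.1 y.1 := by
  classical
  obtain ⟨d, b⟩ := x
  set C := zigzagEdges Z ∩ zigzagEdges Z' with hC
  -- `ψ` goes to the next acute corner of the region at the first end of `a`: run `a` backwards,
  -- turn as `b` says, and stop at the next common edge, directed away from the corner reached.
  have hnext : ∀ a : G.Dart, a.edge ∈ C → ∃ a' : G.Dart, R.IsNextIn C (a.symm, b) (a', !b) := by
    intro a ha
    have ha' : ZigzagState.edge ((a.symm, b) : ZigzagState G) ∈ C := by
      simpa [ZigzagState.edge] using ha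
    obtain ⟨z, hz⟩ := exists_isNextIn (R := R) ha'
    have h1 := h.snd_eq_not hR hcolor ha' hz
    exact ⟨z.1, by rw [← h1]; exact hz⟩
  choose! ψ hψ using hnext
  have hψC : ∀ a : G.Dart, a.edge ∈ C → (ψ a).edge ∈ C := fun a ha => (hψ a ha).edge_mem
  have hψV : ∀ a : G.Dart, a.edge ∈ C →
      R.vertexRegion (Z ∪ Z') (ψ a).fst = R.vertexRegion (Z ∪ Z') a.fst := by
    intro a ha
    have ha' : a.symm.edge ∈ C := by simpa using ha
    exact (hψ a ha).vertexRegion_eq h.union h.not_mem_union (h.mem_union ha' b) rfl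
  have hrev : ∀ a : G.Dart, a.edge ∈ C → R.IsNextIn C ((ψ a).symm, !b) (a, b) := by
    intro a ha
    simpa [ZigzagState.rev] using (hψ a ha).rev (by simpa [ZigzagState.edge] using ha)
  have hψinj : ∀ a a' : G.Dart, a.edge ∈ C → a'.edge ∈ C → ψ a = ψ a' → a = a' := by
    intro a a' ha ha' he
    have h1 := hrev a ha
    rw [he] at h1
    exact congrArg Prod.fst (h1.unique (hrev a' ha'))
  -- The sides met by iterating `ψ` alternate between the two zigzags.
  have hψZ : ∀ a : G.Dart, a.edge ∈ C →
      (((ψ a, b) : ZigzagState G) ∈ Z ↔ ((a, b) : ZigzagState G) ∉ Z) := by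
    intro a ha
    have h1 := (hψ a ha).mem_iff h.left.isZigzagUnion
    rw [h.mem_not_iff (hψC a ha), h.left.isZigzagUnion.symm_mem] at h1
    tauto
  have hdC : d.symm.edge ∈ C := by simpa [ZigzagState.edge] using hx
  have h1C := hψC _ hdC
  have h2C := hψC _ h1C
  have h3C := hψC _ h2C
  -- Otherwise the region has four distinct acute corners: alternation separates those at odd
  -- distance, and injectivity those at distance two.
  have hback : ψ (ψ d.symm) = d.symm := by
    by_contra hne
    have hne' : ∀ a : G.Dart, a.edge ∈ C → a ≠ ψ a := by
      intro a ha he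
      have h1 := hψZ a ha
      rw [← he] at h1
      tauto
    have h03 : d.symm ≠ ψ (ψ (ψ d.symm)) := by
      intro he
      have h1 := hψZ _ hdC
      have h2 := hψZ _ h1C
      have h3 := hψZ _ h2C
      rw [← he] at h3
      tauto
    have hcard : ({d.symm, ψ d.symm, ψ (ψ d.symm), ψ (ψ (ψ d.symm))} : Finset G.Dart).card = 4 := by
      rw [Finset.card_insert_of_notMem, Finset.card_insert_of_notMem, Finset.card_pair]
      · exact hne' _ h2C
      · simp only [Finset.mem_insert, Finset.mem_singleton, not_or]
        exact ⟨hne' _ h1C, fun he => hne (hψinj _ _ hdC h2C he).symm⟩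
      · simp only [Finset.mem_insert, Finset.mem_singleton, not_or]
        exact ⟨hne' _ hdC, Ne.symm hne, h03⟩
    suffices hle : ({d.symm, ψ d.symm, ψ (ψ d.symm), ψ (ψ (ψ d.symm))} : Finset G.Dart).card ≤ 3 by
      omega
    refine h.card_acute_le hR.1 hcubic hfaces (R.vertexRegion (Z ∪ Z') d.symm.fst) _ ?_
    intro a ha
    simp only [Finset.mem_insert, Finset.mem_singleton] at ha
    rcases ha with rfl | rfl | rfl | rfl
    · exact ⟨hdC, rfl⟩
    · exact ⟨h1C, hψV _ hdC⟩
    · exact ⟨h2C, (hψV _ h1C).trans (hψV _ hdC)⟩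
    · exact ⟨h3C, (hψV _ h2C).trans ((hψV _ h1C).trans (hψV _ hdC))⟩
  have hy : y = (ψ d.symm, !b) := hxy.unique (by simpa using hψ _ hdC)
  subst hy
  intro b'
  rcases Bool.eq_or_eq_not b' b with rfl | rfl
  · exact hxy
  -- The other side of the digon is the second arc of `ψ`, reversed.
  · have h1 := hrev _ h1C
    rw [hback, SimpleGraph.Dart.symm_symm] at h1
    simpa using h1

end IsSimplePair

/-! ### Assembling the necklace. -/

/-- The common edges of two simple zigzags of a plane cubic graph with even faces of size at most
six form a necklace of two, four or six digons. -/
theorem IsSimplePair.exists_isNecklace [Finite V] {Z Z' : Set (ZigzagState G)}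
    (h : R.IsSimplePair Z Z') (hR : R.IsPlane)
    (hcubic : ∀ v, (G.neighborSet v).ncard = 3) (hfaces : ∀ d, R.faceSize d ≤ 6)
    (heven : ∀ d, Even (R.faceSize d)) (hne : (zigzagEdges Z ∩ zigzagEdges Z').Nonempty) :
    ∃ k, 0 < k ∧ k ≤ 3 ∧ R.IsNecklace k Z Z' ∧
      (zigzagEdges Z ∩ zigzagEdges Z').ncard = 2 * k := by
  classical
  obtain ⟨color, hcolor⟩ := R.exists_bicoloring hR heven
  obtain ⟨_, ⟨x, hxZ, rfl⟩, hx'⟩ := hne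
  have hx : x.edge ∈ zigzagEdges Z ∩ zigzagEdges Z' := ⟨⟨x, hxZ, rfl⟩, hx'⟩
  set C := zigzagEdges Z ∩ zigzagEdges Z' with hC
  set s : ℕ → ZigzagState G := fun i => (R.nextIn C)^[i] x with hs
  have hsC : ∀ i, (s i).edge ∈ C := iterate_nextIn_edge_mem hx
  have hsnext : ∀ i, R.IsNextIn C (s i) (s (i + 1)) := isNextIn_iterate hx
  have hsnd : ∀ i, (s (i + 1)).2 = !(s i).2 := fun i => h.snd_eq_not hR hcolor (hsC i) (hsnext i)
  have hdigon : ∀ i, R.AcuteDigon C (s i).1 (s (i + 1)).1 := fun i =>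
    h.acuteDigon hR hcubic hfaces hcolor (hsC i) (hsnext i)
  have hcycle : ∀ i, R.step.SameCycle x (s i) := by
    intro i
    induction i with
    | zero => exact Equiv.Perm.SameCycle.refl _ _
    | succ i ih => exact ih.trans (hsnext i).sameCycle
  have hsZ : ∀ i, s i ∈ Z := fun i =>
    (h.left.subset (R.isZigzagUnion_zigzagOf x) hxZ (R.mem_zigzagOf_self x)).antisymm
      (h.left.isZigzagUnion.zigzagOf_subset hxZ) ▸ Or.inl (hcycle i)
  set M := Function.minimalPeriod (R.nextIn C) x with hM
  have hMpos : 0 < M := by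
    obtain ⟨j, hj, hjx⟩ := R.exists_pow_step_eq_self x
    obtain ⟨i, hi, hix⟩ := exists_iterate_nextIn_eq (C := C) j x hx (hjx.symm ▸ hx)
    exact Function.IsPeriodicPt.minimalPeriod_pos (hi hj) (hix.trans hjx)
  have hMx : s M = x := Function.iterate_minimalPeriod
  have hpar : ∀ i, (s (2 * i)).2 = x.2 := by
    intro i
    induction i with
    | zero => rfl
    | succ i ih =>
      change (s (2 * i + 1 + 1)).2 = x.2
      rw [hsnd, hsnd, ih, Bool.not_not]
  -- The turn changes from each common edge to the next, so the period is even.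
  obtain ⟨k, hk⟩ : ∃ k, M = 2 * k := by
    rcases Nat.even_or_odd' M with ⟨k, hk | hk⟩
    · exact ⟨k, hk⟩
    · have h1 := hsnd (2 * k)
      rw [← hk, hMx, hpar] at h1
      simp at h1
  have hkpos : 0 < k := by omega
  have : NeZero (2 * k) := ⟨by omega⟩
  have hmod : ∀ n, s (n % (2 * k)) = s n := by
    intro n
    rw [← hk]
    exact Function.iterate_mod_minimalPeriod_eq
  let d : ZMod (2 * k) → G.Dart := fun i => (s i.val).1
  have hinj : Function.Injective fun i => (d i).edge := by
    intro i j hij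
    have h1 : s j.val = s i.val ∨ s j.val = (s i.val).rev := h.simple_left _ (hsZ _) _ (hsZ _) hij
    rcases h1 with h1 | h1
    · have hlt : ∀ i : ZMod (2 * k), i.val ∈ Set.Iio M := fun i => (ZMod.val_lt i).trans_eq hk.symm
      exact ZMod.val_injective _ (Function.iterate_injOn_Iio_minimalPeriod (hlt i) (hlt j) h1.symm)
    -- Bipartiteness prevents the circuit from retracing an edge backwards with the same turn.
    · refine absurd ?_ (not_sameCycle_rev (R := R) hcolor (s i.val))
      rw [← h1]
      exact (hcycle _).symm.trans (hcycle _)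
  have hrange : Set.range (fun i => (d i).edge) = C := by
    refine Set.Subset.antisymm ?_ ?_
    · rintro _ ⟨i, rfl⟩
      exact hsC _
    · rintro e he
      obtain ⟨y, hy, rfl⟩ := he.1
      have key : ∀ z : ZigzagState G, R.step.SameCycle x z → z.edge ∈ C →
          ∃ i, (d i).edge = z.edge := by
        intro z hz hzC
        obtain ⟨j, -, rfl⟩ := hz.exists_pow_eq'
        obtain ⟨i, -, hi⟩ := exists_iterate_nextIn_eq (C := C) j x hx hzC
        refine ⟨(i : ZMod (2 * k)), ?_⟩
        rw [← hi]
        simp only [d, ZMod.val_natCast, hmod]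
        rfl
      rcases h.left.subset (R.isZigzagUnion_zigzagOf x) hxZ (R.mem_zigzagOf_self x) hy with h1 | h1
      · exact key y h1 he
      · obtain ⟨i, hi⟩ := key y.rev h1 (by simpa using he)
        exact ⟨i, by simpa using hi⟩
  have hcard : C.ncard = 2 * k := by
    rw [← hrange, ← Set.image_univ, Set.ncard_image_of_injective _ hinj, Set.ncard_univ,
      Nat.card_zmod]
  -- Take from each digon the arc that leaves by a left turn: these arcs bound one side of the
  -- necklace, changing zigzag at every common edge, and the faces along them lie in one region.
  have hface : ∀ i, R.faceRegion (Z ∪ Z') (R.face (s i).1) =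
      R.faceRegion (Z ∪ Z') (R.face x.1) := by
    intro i
    induction i with
    | zero => rfl
    | succ i ih =>
      rw [← ih]
      exact IsNextIn.faceRegion_eq (x := ((s i).1, true)) (y := ((s (i + 1)).1, false)) h.union h.not_mem_union
        (h.mem_union (hsC i) true) (hdigon i true) rfl rfl
  have hk3 : k ≤ 3 := by
    have h1 := h.card_obtuse_le hR.1 hcubic hfaces (R.faceRegion (Z ∪ Z') (R.face x.1))
      (Finset.univ.image d) (by
        intro a ha
        obtain ⟨i, -, rfl⟩ := Finset.mem_image.1 ha
        exact ⟨hsC _, hface _⟩)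
    rw [Finset.card_image_of_injective _ (fun i j hij => hinj (congrArg SimpleGraph.Dart.edge hij)),
      Finset.card_univ, ZMod.card] at h1
    omega
  refine ⟨k, hkpos, hk3, ⟨d, hinj, hrange, fun i => ?_⟩, hcard⟩
  have h1 : d (i + 1) = (s (i.val + 1)).1 := by
    simp only [d]
    rw [← hmod (i.val + 1), ZMod.val_add, ZMod.val_one_eq_one_mod, Nat.add_mod_mod]
  rw [h1]
  exact hdigon _

end RotationSystem

theorem theorem6p4 {V : Type*} [Finite V] {G : SimpleGraph V} (R : RotationSystem G) (n : ℕ)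
    (hG : IsTypeFour R n) (Z Z' : Set (ZigzagState G))
    (hZ : R.IsZigzag Z) (hZ' : R.IsZigzag Z') (hne : Z ≠ Z')
    (hs : IsSimpleZigzag Z) (hs' : IsSimpleZigzag Z')
    (hint : (zigzagEdges Z ∩ zigzagEdges Z').Nonempty) :
    (R.IsNecklace 1 Z Z' ∨ R.IsNecklace 2 Z Z' ∨ R.IsNecklace 3 Z Z') ∧
      ((zigzagEdges Z ∩ zigzagEdges Z').ncard = 2 ∨
        (zigzagEdges Z ∩ zigzagEdges Z').ncard = 4 ∨
        (zigzagEdges Z ∩ zigzagEdges Z').ncard = 6) := by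
  obtain ⟨k, hk, hk3, hneck, hcard⟩ :=
    RotationSystem.IsSimplePair.exists_isNecklace ⟨hZ, hZ', hne, hs, hs'⟩ hG.plane hG.cubic
      (fun d => by rcases hG.faces d with h | h <;> omega)
      (fun d => by rcases hG.faces d with h | h <;> rw [h] <;> decide) hint
  interval_cases k
  · exact ⟨Or.inl hneck, Or.inl hcard⟩
  · exact ⟨Or.inr (Or.inl hneck), Or.inr (Or.inl hcard)⟩
  · exact ⟨Or.inr (Or.inr hneck), Or.inr (Or.inr hcard)⟩
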